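/- Let $(R,\mathfrak m)$ be a Cohen–Macaulay local ring of dimension $d$ with infinite residue field, let $I$ be an $\mathfrak m$-primary ideal, and let $\mathcal I=\{I_n\}_{n\in\mathbb Z}$ be an $I$-admissible filtration, i.e. a chain of ideals with $I_0=R$, $I_n\supseteq I_{n+1}$, $I_mI_n\subseteq I_{m+n}$ and $I^n\subseteq I_n$ for all $m,n\in\mathbb Z$, such that for some $k\in\mathbb N$ one has $I_n\subseteq I^{n-k}$ for all $n\in\mathbb Z$ (where $I^n=R$ for $n\le 0$). Let $\mathcal R'(\mathcal I)=\bigoplus_{n\in\mathbb Z}I_nt^n\subseteq R[t,t^{-1}]$ and let $G(\mathcal I)=\mathcal R'(\mathcal I)/t^{-1}\mathcal R'(\mathcal I)$ be the associated graded ring, with homogeneous maximal ideal $M$. For $i\ge 0$ put $$a_i(G(\mathcal I))=\max\{n\in\mathbb Z \mid [H^i_M(G(\mathcal I))]_n\neq 0\}$$ ($-\infty$ if $H^i_M(G(\mathcal I))=0$), where $H^i_M$ denotes graded local cohomology. Let $\ell$ be an integer with $\ell>\max\{a_i(G(\mathcal I))\mid 0\le i\le d\}$ and let $\mathcal I^{(\ell)}=\{I_{n\ell}\}_{n\in\mathbb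 Z}$. Write $\ell_R$ for length of $R$-modules. Then there are integers $e_i(\mathcal I^{(\ell)})$, $0\le i\le d$ (the Hilbert coefficients of $\mathcal I^{(\ell)}$), with $$\ell_R(R/I_{\ell(n+1)})=\sum_{i=0}^d(-1)^i e_i(\mathcal I^{(\ell)})\binom{n+d-i}{d-i}$$ for all sufficiently large $n$, all these lengths are finite, and the equality holds for every $n\ge 0$. In particular, $$\ell_R(R/I_\ell)=\sum_{i=0}^d(-1)^i e_i(\mathcal I^{(\ell)}).$$ -/

import Mathlib

open scoped LaurentPolynomial

noncomputable section

/-- A local ring is Cohen-Macaulay if it is Noetherian and its maximal ideal contains a regular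
sequence whose length is the Krull dimension of the ring. -/
structure IsCohenMacaulayLocalRing (R : Type*) [CommRing R] [IsLocalRing R] : Prop where
  isNoetherianRing : IsNoetherianRing R
  exists_isRegular : ∃ rs : List R, (∀ r ∈ rs, r ∈ IsLocalRing.maximalIdeal R) ∧
    RingTheory.Sequence.IsRegular R rs ∧ (rs.length : WithBot ℕ∞) = ringKrullDim R

/-! ### Filtrations, the extended Rees algebra and the associated graded ring -/

/-- A multiplicative filtration of ideals indexed by `ℤ`:
`I₀ = R`, `Iₙ ⊇ Iₙ₊₁` and `Iₘ Iₙ ⊆ Iₘ₊ₙ`. -/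
structure MulFiltration (R : Type*) [CommRing R] where
  ideal : ℤ → Ideal R
  zero : ideal 0 = ⊤
  anti : ∀ n, ideal (n + 1) ≤ ideal n
  mul_le : ∀ m n, ideal m * ideal n ≤ ideal (m + n)

namespace MulFiltration

/-- The filtration is `I`-admissible: `Iⁿ ⊆ Iₙ` for all `n`, and there is `k` with `Iₙ ⊆ Iⁿ⁻ᵏ` for
all `n`; here `Iⁿ = R` for `n ≤ 0`. -/
structure IsAdmissible {R : Type*} [CommRing R] (F : MulFiltration R) (I : Ideal R) : Prop where
  pow_le : ∀ n : ℤ, I ^ n.toNat ≤ F.ideal n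
  le_pow : ∃ k : ℕ, ∀ n : ℤ, F.ideal n ≤ I ^ (n - k).toNat

/-- The Veronese family `n ↦ I_{nℓ}`. -/
def veronese {R : Type*} [CommRing R] (F : MulFiltration R) (l : ℤ) : ℤ → Ideal R :=
  fun n => F.ideal (n * l)

variable {R : Type*} [CommRing R] (F : MulFiltration R)

lemma ideal_eq_top_of_nonpos {n : ℤ} (hn : n ≤ 0) : F.ideal n = ⊤ := by
  have h : Antitone F.ideal := antitone_int_of_succ_le F.anti
  exact top_le_iff.mp (F.zero ▸ h hn)

/-- The extended Rees algebra `⨁_{n ∈ ℤ} Iₙ tⁿ`, as a subalgebra of `R[t, t⁻¹]`. -/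
def extendedRees : Subalgebra R R[T;T⁻¹] where
  carrier := {p | ∀ n, p.coeff n ∈ F.ideal n}
  algebraMap_mem' r n := by
    rw [← LaurentPolynomial.C_eq_algebraMap, LaurentPolynomial.C_apply]
    split_ifs with h
    · simp [h, F.zero]
    · exact zero_mem _
  add_mem' hp hq n := by
    simpa using add_mem (hp n) (hq n)
  mul_mem' {p q} hp hq n := by
    classical
    rw [AddMonoidAlgebra.coeff_mul]
    refine sum_mem fun i _ => sum_mem fun j _ => ?_
    dsimp only
    split_ifs with h
    · exact h ▸ F.mul_le i j (Ideal.mul_mem_mul (hp i) (hq j))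
    · exact zero_mem _

/-- The element `t⁻¹` of the extended Rees algebra. -/
def tInv : F.extendedRees :=
  ⟨LaurentPolynomial.T (-1), fun n => by
    rw [LaurentPolynomial.T_apply]
    split_ifs with h
    · simp [F.ideal_eq_top_of_nonpos (show n ≤ 0 by omega)]
    · exact zero_mem _⟩

/-- The associated graded ring: the extended Rees algebra modulo `t⁻¹`. -/
abbrev AssociatedGraded : Type _ := F.extendedRees ⧸ Ideal.span {F.tInv}

/-- The component `Iₙ tⁿ` of the extended Rees algebra. -/
def reesPiece (n : ℤ) : Submodule R F.extendedRees where
  carrier := {p | ∀ m, m ≠ n → (p : R[T;T⁻¹]).coeff m = 0}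
  add_mem' hp hq m hm := by simp [hp m hm, hq m hm]
  zero_mem' m _ := by simp
  smul_mem' r p hp m hm := by simp [hp m hm]

/-- The degree-`n` component of the associated graded ring, i.e. the image of `Iₙ tⁿ`. -/
def gradedPiece (n : ℤ) : Submodule R F.AssociatedGraded :=
  (F.reesPiece n).map (Ideal.Quotient.mkₐ R (Ideal.span {F.tInv})).toLinearMap

/-- The homogeneous maximal ideal `M` of the associated graded ring of a filtration over a local
ring: it is generated by the image of the maximal ideal and by the components of positive degree. -/
def homogeneousMaximalIdeal [IsLocalRing R] : Ideal F.AssociatedGraded :=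
  Ideal.span (algebraMap R F.AssociatedGraded '' IsLocalRing.maximalIdeal R ∪
    ⋃ n : ℤ, ⋃ _ : 0 < n, (F.gradedPiece n : Set F.AssociatedGraded))

end MulFiltration

/-! ### Graded local cohomology

The local cohomology `H^i_M(N)` of a graded module `N`, with its grading, as the cohomology of the
Čech complex `0 → N → ⨁ N_{f_j} → ⨁ N_{f_j f_k} → ⋯ → N_{f_1 ⋯ f_r} → 0` of homogeneous elements
`f_1, …, f_r` that generate the ideal `M` up to radical. -/

/-- The `f j` are homogeneous and generate `M` up to radical. -/
structure IsHomogeneousSystem {R A : Type*} [CommRing R] [CommRing A] [Algebra R A]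
    (𝒜 : ℤ → Submodule R A) (M : Ideal A) {r : ℕ} (f : Fin r → A) : Prop where
  homogeneous : ∀ j, ∃ a, f j ∈ 𝒜 a
  radical_span : (Ideal.span (Set.range f)).radical = M.radical

namespace GradedCech

variable {R A : Type*} [CommRing R] [CommRing A] [Algebra R A] {r : ℕ} (f : Fin r → A)

/-- The multiplicative set generated by the `f j` with `j ∈ S`. -/
def mulSet (S : Finset (Fin r)) : Submonoid A := Submonoid.closure (f '' (S : Set (Fin r)))

lemma mulSet_mono {S S' : Finset (Fin r)} (h : S ⊆ S') : mulSet f S ≤ mulSet f S' :=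
  Submonoid.closure_mono (Set.image_mono (Finset.coe_subset.mpr h))

variable (N : Type*) [AddCommGroup N] [Module A N] [Module R N] [IsScalarTower R A N]

/-- The localization of `N` at the product of the `f j` with `j ∈ S`. -/
abbrev Loc (S : Finset (Fin r)) : Type _ := LocalizedModule (mulSet f S) N

/-- The localization map between two such localizations. -/
def res {S S' : Finset (Fin r)} (h : S ⊆ S') : Loc f N S →ₗ[R] Loc f N S' :=
  (LocalizedModule.liftOfLE (mulSet f S) (mulSet f S') (mulSet_mono f h)).restrictScalars R

/-- The Čech differential, on families indexed by all subsets `S` of `{1, …, r}`: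
`(dσ)(S) = ∑_{j ∈ S} ± σ(S ∖ {j})`, with the sign `(-1)^#{k ∈ S | k < j}`. -/
def differential : (∀ S : Finset (Fin r), Loc f N S) →ₗ[R] (∀ S : Finset (Fin r), Loc f N S) :=
  LinearMap.pi fun S => ∑ j ∈ S, ((-1 : ℤ) ^ (S.filter (· < j)).card) •
    (res (R := R) f N (S.erase_subset j)).comp (LinearMap.proj (S.erase j))

variable {N}
variable (𝒜 : ℤ → Submodule R A) (𝒩 : ℤ → Submodule R N)

/-- The degree-`n` component of the localization: it consists of the fractions `g / s` with `s`
homogeneous of some degree `a` and `g` homogeneous of degree `n + a`. -/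
def locPiece (S : Finset (Fin r)) (n : ℤ) : Submodule R (Loc f N S) :=
  Submodule.span R {z | ∃ (a : ℤ) (s : mulSet f S) (g : N),
    (s : A) ∈ 𝒜 a ∧ g ∈ 𝒩 (n + a) ∧ z = LocalizedModule.mk g s}

/-- The degree-`n` component of the `p`-th term of the Čech complex: families supported on the
subsets of cardinality `p`, with values of degree `n`. -/
def cochains (p : ℕ) (n : ℤ) : Submodule R (∀ S : Finset (Fin r), Loc f N S) where
  carrier := {σ | ∀ S, σ S ∈ locPiece f 𝒜 𝒩 S n ∧ (S.card ≠ p → σ S = 0)}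
  add_mem' hσ hτ S := ⟨add_mem (hσ S).1 (hτ S).1, fun h => by simp [(hσ S).2 h, (hτ S).2 h]⟩
  zero_mem' S := ⟨zero_mem _, fun _ => rfl⟩
  smul_mem' c σ hσ S := ⟨Submodule.smul_mem _ c (hσ S).1, fun h => by simp [(hσ S).2 h]⟩

/-- Cocycles of degree `n` in the `p`-th term. -/
def cocycles (p : ℕ) (n : ℤ) : Submodule R (∀ S : Finset (Fin r), Loc f N S) :=
  cochains f 𝒜 𝒩 p n ⊓ LinearMap.ker (differential (R := R) f N)

/-- Coboundaries of degree `n` in the `p`-th term (zero for `p = 0`). -/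
def coboundaries (p : ℕ) (n : ℤ) : Submodule R (∀ S : Finset (Fin r), Loc f N S) :=
  match p with
  | 0 => ⊥
  | q + 1 => (cochains f 𝒜 𝒩 q n).map (differential (R := R) f N)

/-- The degree-`n` component of the `p`-th Čech cohomology module, i.e. `[H^p_M(N)]_n` when the
`f j` generate `M` up to radical. -/
abbrev cohomology (p : ℕ) (n : ℤ) : Type _ :=
  cocycles f 𝒜 𝒩 p n ⧸ (coboundaries f 𝒜 𝒩 p n).submoduleOf (cocycles f 𝒜 𝒩 p n)

/-- The invariant `a_i(N) = max {n | [H^i_M(N)]_n ≠ 0}`; it is `⊥ = -∞` if `H^i_M(N) = 0`. -/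
def aInvariant (i : ℕ) : WithBot (WithTop ℤ) :=
  ⨆ n : {n : ℤ // Nontrivial (cohomology f 𝒜 𝒩 i n)}, (((n : ℤ) : WithTop ℤ) : WithBot (WithTop ℤ))

end GradedCech

/-! ### Hilbert coefficients -/

/-- The length of `R / J` as an integer (`0` if the length is infinite). -/
def colength {R : Type*} [CommRing R] (J : Ideal R) : ℤ := (Module.length R (R ⧸ J)).toNat

/-- The value at `n` of the polynomial `∑_{i=0}^d (-1)^i e_i binom(n+d-i, d-i)`. -/
def hilbertSum (d : ℕ) (e : Fin (d + 1) → ℤ) (n : ℕ) : ℤ :=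
  ∑ i : Fin (d + 1), (-1) ^ (i : ℕ) * e i * ((n + d - i).choose (d - i) : ℤ)

/-- The integers `e_0, …, e_d` are the Hilbert coefficients of the family `J` of ideals:
`ℓ(R / J_{n+1}) = ∑_{i=0}^d (-1)^i e_i binom(n+d-i, d-i)` for all large `n`. -/
def IsHilbertCoeffs {R : Type*} [CommRing R] (J : ℤ → Ideal R) (d : ℕ)
    (e : Fin (d + 1) → ℤ) : Prop :=
  ∀ᶠ n : ℕ in Filter.atTop, Module.length R (R ⧸ J (n + 1)) ≠ ⊤ ∧
    colength (J (n + 1)) = hilbertSum d e n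

open Classical in
/-- The Hilbert coefficients `e_0, …, e_d` of a family of ideals (`0` if there are none). -/
def hilbertCoeff {R : Type*} [CommRing R] (J : ℤ → Ideal R) (d : ℕ) : Fin (d + 1) → ℤ :=
  if h : ∃ e, IsHilbertCoeffs J d e then h.choose else 0

end

/-! Put `G = ⨁ Iₙ / Iₙ₊₁`. Since `ℓ(R/Iₙ₊₁) - ℓ(R/Iₙ) = ℓ(Gₙ)`, the heart of the matter is that the
Hilbert function of `G` equals its Hilbert polynomial in all degrees `≥ l` once the `Hⁱ(G)`, `i ≤
d`, vanish there. Then `ℓ(R/Iₙ) - Q(n)` is constant for `n ≥ l`, where `Q` is the Hilbert–Samuel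
polynomial, and this constant is zero because it is zero for large `n`. Substituting `l(n+1)`, which
is `≥ l` when `l > 0` and `n ≥ 0`, and expanding in binomials gives the `eᵢ`.

The statement about `G` usually follows from the Grothendieck–Serre formula. Here
`IsGradedWithLinearForms.exists_hilbertPolynomial` proves it directly, by Noetherian induction over
cyclic graded quotients `N` of `G`. The infinite residue field provides a linear form `x` whose
kernel on `N` is killed by a power of `M` (`exists_avoiding`, `exists_filterRegular`); this kernel
is zero in large degrees and in every degree where `H⁰(N)` is zero. Wherever `x` is injective, the
Hilbert function of `N / x N` is the backward difference of that of `N`. Moreover `Hᵖ(N / x N)ₙ`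
vanishes when `Hᵖ(N)ₙ` and `Hᵖ⁺¹(N)ₙ₋₁` do (`cocycles_le_coboundaries_of_quotient`). So the degree
of the polynomial and the number of cohomology groups needed drop together.

That `i ≤ d` suffices rests on `deg Q ≤ d`, which comes from the growth estimate `ℓ(R/Iⁿ) ≤ C nᵈ`
(`exists_length_quotient_pow_le`). -/

noncomputable section

/-! ### Numerical polynomials -/

/-- The functions `ℤ → ℤ` given by a polynomial over `ℚ` of degree less than `k`. -/
def IsNumPoly (k : ℕ) (q : ℤ → ℤ) : Prop :=
  ∃ p : Polynomial ℚ, p.degree < k ∧ ∀ n : ℤ, (q n : ℚ) = p.eval (n : ℚ)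

namespace IsNumPoly

open Polynomial

lemma mono {k k' : ℕ} {q : ℤ → ℤ} (h : IsNumPoly k q) (hk : k ≤ k') : IsNumPoly k' q := by
  obtain ⟨p, hp, h⟩ := h
  exact ⟨p, hp.trans_le (by exact_mod_cast hk), h⟩

lemma eq_zero {q : ℤ → ℤ} (h : IsNumPoly 0 q) (n : ℤ) : q n = 0 := by
  obtain ⟨p, hp, h⟩ := h
  have hp0 : p = 0 := by
    rw [← Polynomial.degree_eq_bot]
    exact Nat.WithBot.lt_zero_iff.mp (by simpa using hp)
  have := h n
  rw [hp0, eval_zero] at this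
  exact_mod_cast this

lemma zero (k : ℕ) : IsNumPoly k 0 := ⟨0, by simp [bot_lt_iff_ne_bot], by simp⟩

lemma add {k : ℕ} {q q' : ℤ → ℤ} (h : IsNumPoly k q) (h' : IsNumPoly k q') :
    IsNumPoly k (q + q') := by
  obtain ⟨p, hp, h⟩ := h
  obtain ⟨p', hp', h'⟩ := h'
  exact ⟨p + p', (degree_add_le _ _).trans_lt (max_lt hp hp'), fun n => by simp [h, h']⟩

lemma const_mul {k : ℕ} {q : ℤ → ℤ} (h : IsNumPoly k q) (c : ℤ) :
    IsNumPoly k (fun n => c * q n) := by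
  obtain ⟨p, hp, h⟩ := h
  refine ⟨C (c : ℚ) * p, lt_of_le_of_lt ?_ hp, fun n => by simp [h]⟩
  rw [← smul_eq_C_mul]
  exact degree_smul_le _ _

lemma sum {k : ℕ} {ι : Type*} (s : Finset ι) {q : ι → ℤ → ℤ} (h : ∀ i ∈ s, IsNumPoly k (q i)) :
    IsNumPoly k (fun n => ∑ i ∈ s, q i n) := by
  classical
  induction s using Finset.induction_on with
  | empty => exact zero k
  | insert a s ha ih =>
    simp_rw [Finset.sum_insert ha]
    exact (h a (by simp)).add (ih fun i hi => h i (by simp [hi]))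

/-- This is what passes from the filtration to its Veronese, through `n ↦ l n + l`. -/
lemma comp_affine {k : ℕ} {q : ℤ → ℤ} (h : IsNumPoly k q) (a b : ℤ) :
    IsNumPoly k (fun n => q (a * n + b)) := by
  obtain ⟨p, hp, h⟩ := h
  refine ⟨p.comp (C (a : ℚ) * X + C (b : ℚ)), ?_, fun n => by simp [h]⟩
  by_cases hp0 : p.comp (C (a : ℚ) * X + C (b : ℚ)) = 0
  · rw [hp0, degree_zero]
    exact WithBot.bot_lt_coe k
  have hp' : p ≠ 0 := by rintro rfl; simp at hp0
  rw [degree_eq_natDegree hp'] at hp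
  rw [degree_eq_natDegree hp0]
  refine lt_of_le_of_lt ?_ hp
  have h1 : (C (a : ℚ) * X + C (b : ℚ)).natDegree ≤ 1 := natDegree_linear_le
  have := natDegree_comp_le (p := p) (q := C (a : ℚ) * X + C (b : ℚ))
  exact_mod_cast this.trans (by nlinarith)

lemma eq_of_eventually_eq {k k' : ℕ} {q q' : ℤ → ℤ} (h : IsNumPoly k q) (h' : IsNumPoly k' q')
    {n₀ : ℤ} (hn : ∀ n ≥ n₀, q n = q' n) : q = q' := by
  obtain ⟨p, -, h⟩ := h
  obtain ⟨p', -, h'⟩ := h'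
  have hp : p = p' := by
    refine Polynomial.eq_of_infinite_eval_eq p p'
      (((Set.Ici_infinite n₀).image (Int.cast_injective (α := ℚ)).injOn).mono ?_)
    rintro _ ⟨n, hnn, rfl⟩
    simp only [Set.mem_ofPred_eq]
    rw [← h, ← h', hn n hnn]
  ext n
  have := (h n).trans ((congrArg _ hp).trans (h' n).symm)
  exact_mod_cast this

/-- The backward difference lowers the degree. -/
lemma sub_shift {k : ℕ} {q : ℤ → ℤ} (h : IsNumPoly (k + 1) q) :
    IsNumPoly k (fun n => q n - q (n - 1)) := by
  obtain ⟨p, hp, h⟩ := h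
  refine ⟨p - p.comp (X - C 1), ?_, fun n => by simp [h]⟩
  by_cases hp0 : p = 0
  · simp [hp0, bot_lt_iff_ne_bot]
  -- The translate has the same degree and leading coefficient, so the top terms cancel.
  have hlt : (p - p.comp (X - C 1)).degree < p.degree := by
    refine degree_sub_lt_left ?_ hp0 ?_
    · have hne : p.comp (X - C 1) ≠ 0 := by
        rw [sub_eq_add_neg, ← C_neg]
        exact comp_X_add_C_ne_zero_iff.mpr hp0
      rw [degree_eq_natDegree hp0, degree_eq_natDegree hne, natDegree_comp, natDegree_X_sub_C,
        mul_one]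
    · rw [leadingCoeff_comp (by rw [natDegree_X_sub_C]; exact one_ne_zero), leadingCoeff_X_sub_C]
      simp
  rw [degree_eq_natDegree hp0] at hp hlt
  refine hlt.trans_le ?_
  have : p.natDegree < k + 1 := by exact_mod_cast hp
  exact_mod_cast Nat.lt_succ_iff.mp this

end IsNumPoly

/-- The function `n ↦ binom(n + j, j)` on the integers. -/
def binomPoly (j : ℕ) (n : ℤ) : ℤ := Ring.choose (n + j) j

lemma binomPoly_zero (n : ℤ) : binomPoly 0 n = 1 := by simp [binomPoly]

lemma binomPoly_natCast (j n : ℕ) : binomPoly j n = ((n + j).choose j : ℤ) := by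
  rw [binomPoly, ← Nat.cast_add, Ring.choose_natCast]

/-- Pascal's rule: the backward difference shifts the binomial basis down by one. -/
lemma binomPoly_succ_sub (j : ℕ) (n : ℤ) :
    binomPoly (j + 1) n - binomPoly (j + 1) (n - 1) = binomPoly j n := by
  have := Ring.choose_succ_succ (n + j) j
  simp only [binomPoly]
  push_cast
  rw [show n + ((j : ℤ) + 1) = n + j + 1 by ring, show n - 1 + ((j : ℤ) + 1) = n + j by ring, this]
  ring

lemma isNumPoly_binomPoly (j : ℕ) : IsNumPoly (j + 1) (binomPoly j) := by
  open Polynomial in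
  have h : ∀ n : ℤ, ((binomPoly j n : ℤ) : ℚ) =
      (C ((j.factorial : ℚ)⁻¹) * (descPochhammer ℚ j).comp (X + C (j : ℚ))).eval (n : ℚ) := by
    intro n
    have h1 := Ring.descPochhammer_eq_factorial_smul_choose (n + j : ℤ) j
    rw [← Polynomial.eval_eq_smeval] at h1
    have h2 : (descPochhammer ℚ j).eval ((n : ℚ) + j) = j.factorial * (binomPoly j n : ℤ) := by
      rw [← descPochhammer_map (Int.castRingHom ℚ),
        show (n : ℚ) + j = ((n + j : ℤ) : ℚ) by push_cast; ring,
        ← eq_intCast (Int.castRingHom ℚ) (n + j), Polynomial.eval_map_apply, h1]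
      simp [binomPoly]
    simp only [eval_mul, eval_C, eval_comp, eval_add, eval_X]
    rw [h2]
    field_simp
  refine ⟨_, ?_, h⟩
  open Polynomial in
  refine lt_of_le_of_lt ?_ (show ((j : ℕ) : WithBot ℕ) < ((j + 1 : ℕ) : WithBot ℕ) by
    exact_mod_cast Nat.lt_succ_self j)
  rw [← Polynomial.smul_eq_C_mul]
  refine (Polynomial.degree_smul_le _ _).trans ?_
  refine Polynomial.degree_le_of_natDegree_le (Polynomial.natDegree_comp_le.trans ?_)
  rw [Polynomial.natDegree_X_add_C, mul_one, descPochhammer_natDegree]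

/-- Newton's expansion of a numerical polynomial. -/
lemma IsNumPoly.exists_expansion {k : ℕ} {q : ℤ → ℤ} (h : IsNumPoly k q) :
    ∃ c : ℕ → ℤ, ∀ n, q n = ∑ j ∈ Finset.range k, c j * binomPoly j n := by
  induction k generalizing q with
  | zero => exact ⟨0, fun n => by simpa using h.eq_zero n⟩
  | succ k ih =>
    obtain ⟨c, hc⟩ := ih h.sub_shift
    -- Raising each index by one antidifferentiates the expansion of the difference, so `q - g` is
    -- constant and supplies the coefficient of index `0`.
    set g : ℤ → ℤ := fun n => ∑ j ∈ Finset.range k, c j * binomPoly (j + 1) n with hg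
    have hstep : ∀ n, q n - g n = q (n - 1) - g (n - 1) := by
      intro n
      have h1 : g n - g (n - 1) = ∑ j ∈ Finset.range k, c j * binomPoly j n := by
        rw [hg, ← Finset.sum_sub_distrib]
        exact Finset.sum_congr rfl fun j _ => by rw [← mul_sub, binomPoly_succ_sub]
      have h2 := hc n
      linarith
    have hconst : ∀ n, q n - g n = q 0 - g 0 := by
      intro n
      induction n using Int.induction_on with
      | zero => rfl
      | succ i hi => rw [hstep, show (i : ℤ) + 1 - 1 = i by ring, hi]
      | pred i hi => rw [← hstep, hi]
    refine ⟨fun j => if j = 0 then q 0 - g 0 else c (j - 1), fun n => ?_⟩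
    rw [Finset.sum_range_succ']
    have := hconst n
    simp only [Nat.add_eq_zero_iff, one_ne_zero, and_false, if_false, if_true, binomPoly_zero,
      Nat.add_sub_cancel, mul_one]
    change q n = g n + _
    linarith

lemma isNumPoly_sum_binomPoly (k : ℕ) (c : ℕ → ℤ) :
    IsNumPoly k (fun n => ∑ j ∈ Finset.range k, c j * binomPoly j n) :=
  IsNumPoly.sum _ fun j hj =>
    ((isNumPoly_binomPoly j).mono (by simpa using hj)).const_mul (c j)

/-- Numerical polynomials have antidifferences with a prescribed value. -/
lemma IsNumPoly.exists_antidifference {k : ℕ} {q : ℤ → ℤ} (h : IsNumPoly k q) (n₀ a : ℤ) :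
    ∃ Q, IsNumPoly (k + 1) Q ∧ (∀ n, Q n - Q (n - 1) = q n) ∧ Q n₀ = a := by
  obtain ⟨c, hc⟩ := h.exists_expansion
  set g : ℤ → ℤ := fun n => ∑ j ∈ Finset.range k, c j * binomPoly (j + 1) n with hg
  have hgp : IsNumPoly (k + 1) g := IsNumPoly.sum _ fun j hj =>
    ((isNumPoly_binomPoly (j + 1)).mono (by simpa using hj)).const_mul (c j)
  refine ⟨fun n => g n + (a - g n₀) * binomPoly 0 n, hgp.add
    (((isNumPoly_binomPoly 0).mono (by omega)).const_mul _), fun n => ?_, by simp [binomPoly_zero]⟩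
  simp only [hc n, binomPoly_zero]
  rw [add_sub_add_right_eq_sub, hg, ← Finset.sum_sub_distrib]
  exact Finset.sum_congr rfl fun j _ => by rw [← mul_sub, binomPoly_succ_sub]

/-- A numerical polynomial bounded by `C n ^ d` has degree at most `d`. -/
lemma IsNumPoly.of_le_pow {k d : ℕ} {q : ℤ → ℤ} (h : IsNumPoly k q) (C : ℤ) {n₀ : ℕ}
    (hC : ∀ n : ℕ, n₀ ≤ n → 0 ≤ q n ∧ q n ≤ C * (n : ℤ) ^ d) : IsNumPoly (d + 1) q := by
  obtain ⟨p, hp, h⟩ := h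
  refine ⟨p, ?_, h⟩
  by_contra hdeg
  rw [not_lt] at hdeg
  have hlt : (Polynomial.X ^ d : Polynomial ℚ).degree < p.degree := by
    rw [Polynomial.degree_X_pow]
    refine lt_of_lt_of_le ?_ hdeg
    exact_mod_cast Nat.lt_succ_self d
  have ht := (p.abs_div_tendsto_atTop_atTop_of_degree_gt _ hlt (by simp)).comp
    (tendsto_natCast_atTop_atTop (R := ℚ))
  obtain ⟨n, hn, hn1⟩ := ((ht.eventually_gt_atTop (C : ℚ)).and
    (Filter.eventually_ge_atTop (n₀ + 1))).exists
  simp only [Function.comp_apply, Polynomial.eval_pow, Polynomial.eval_X] at hn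
  obtain ⟨h0, h1⟩ := hC n (by omega)
  have hpos : (0 : ℚ) < (n : ℚ) ^ d := pow_pos (by exact_mod_cast (by omega : 0 < n)) d
  have hv : p.eval (n : ℚ) = (q n : ℚ) := by rw [h]; simp
  rw [hv, abs_of_nonneg (div_nonneg (by exact_mod_cast h0) hpos.le), lt_div_iff₀ hpos] at hn
  have h2 : (q n : ℚ) ≤ C * (n : ℚ) ^ d := by exact_mod_cast h1
  linarith

/-- The substitution is `j = d - i`; the default `0` is never taken in the range of summation. -/
lemma hilbertSum_eq_sum_binomPoly (d : ℕ) (e : Fin (d + 1) → ℤ) (n : ℕ) :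
    hilbertSum d e n = ∑ j ∈ Finset.range (d + 1),
      ((-1) ^ (d - j) * if h : d - j < d + 1 then e ⟨d - j, h⟩ else 0) * binomPoly j n := by
  rw [← Finset.sum_range_reflect, ← Fin.sum_univ_eq_sum_range (fun j =>
    ((-1) ^ (d - (d + 1 - 1 - j)) *
      if h : d - (d + 1 - 1 - j) < d + 1 then e ⟨d - (d + 1 - 1 - j), h⟩ else 0) *
        binomPoly (d + 1 - 1 - j) n), hilbertSum]
  refine Finset.sum_congr rfl fun i _ => ?_
  have hi : (i : ℕ) ≤ d := Nat.lt_succ_iff.mp i.2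
  have h1 : d - (d + 1 - 1 - i) = i := by omega
  have h2 : d + 1 - 1 - (i : ℕ) = d - i := by omega
  rw [h2] at h1 ⊢
  rw [binomPoly_natCast, Nat.add_sub_assoc hi, dif_pos (by omega)]
  simp only [h1, Fin.eta]

lemma exists_isNumPoly_hilbertSum (d : ℕ) (e : Fin (d + 1) → ℤ) :
    ∃ q, IsNumPoly (d + 1) q ∧ ∀ n : ℕ, q n = hilbertSum d e n :=
  ⟨_, isNumPoly_sum_binomPoly _ _, fun n => (hilbertSum_eq_sum_binomPoly d e n).symm⟩

lemma IsNumPoly.exists_eq_hilbertSum {d : ℕ} {q : ℤ → ℤ} (h : IsNumPoly (d + 1) q) :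
    ∃ e : Fin (d + 1) → ℤ, ∀ n : ℕ, q n = hilbertSum d e n := by
  obtain ⟨c, hc⟩ := h.exists_expansion
  refine ⟨fun i => (-1) ^ (i : ℕ) * c (d - i), fun n => ?_⟩
  rw [hc, hilbertSum_eq_sum_binomPoly]
  refine Finset.sum_congr rfl fun j hj => ?_
  have hj : j ≤ d := Nat.lt_succ_iff.mp (Finset.mem_range.mp hj)
  rw [dif_pos (by omega), ← mul_assoc, ← mul_pow, Nat.sub_sub_self hj]
  simp

/-- `hilbertCoeff` is a choice known only by its values for large `n`; rigidity of polynomials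
carries these to every `n`. -/
lemma hilbertSum_eq_of_eventually_eq {d : ℕ} {e e' : Fin (d + 1) → ℤ} {n₀ : ℕ}
    (h : ∀ n ≥ n₀, hilbertSum d e n = hilbertSum d e' n) : hilbertSum d e = hilbertSum d e' := by
  obtain ⟨q, hq, hqe⟩ := exists_isNumPoly_hilbertSum d e
  obtain ⟨q', hq', hqe'⟩ := exists_isNumPoly_hilbertSum d e'
  have := hq.eq_of_eventually_eq hq' (n₀ := n₀) fun n hn => by
    lift n to ℕ using (by omega)
    rw [hqe, hqe', h n (by exact_mod_cast hn)]
  ext n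
  rw [← hqe, ← hqe', this]

/-! ### Čech cohomology -/

namespace GradedCech

/-! ### The ungraded Čech complex and its functoriality -/

section Complex

variable {R A : Type*} [CommRing R] [CommRing A] [Algebra R A] {r : ℕ} (f : Fin r → A)
variable (N : Type*) [AddCommGroup N] [Module A N] [Module R N] [IsScalarTower R A N]
variable {N' : Type*} [AddCommGroup N'] [Module A N'] [Module R N'] [IsScalarTower R A N']

lemma res_mk {S S' : Finset (Fin r)} (h : S ⊆ S') (g : N) (s : mulSet f S) :
    res (R := R) f N h (LocalizedModule.mk g s) =
      LocalizedModule.mk g ⟨s.1, mulSet_mono f h s.2⟩ := by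
  rw [IsLocalizedModule.mk_eq_mk', IsLocalizedModule.mk_eq_mk']
  exact IsLocalizedModule.liftOfLE_mk' _ _ _ _ _ _ _

lemma res_res {S S' S'' : Finset (Fin r)} (h : S ⊆ S') (h' : S' ⊆ S'') (z : Loc f N S) :
    res (R := R) f N h' (res (R := R) f N h z) = res (R := R) f N (h.trans h') z := by
  induction z using LocalizedModule.induction_on with
  | _ g s => simp only [res_mk]

lemma res_smul {S S' : Finset (Fin r)} (h : S ⊆ S') (x : A) (z : Loc f N S) :
    res (R := R) f N h (x • z) = x • res (R := R) f N h z := by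
  induction z using LocalizedModule.induction_on with
  | _ g s => simp only [res_mk, LocalizedModule.smul'_mk]

/-- The map of localizations induced by a linear map. -/
def locMap (φ : N →ₗ[A] N') (S : Finset (Fin r)) : Loc f N S →ₗ[R] Loc f N' S :=
  ((LocalizedModule.map (mulSet f S) φ).restrictScalars A).restrictScalars R

variable {N}

lemma locMap_mk (φ : N →ₗ[A] N') {S : Finset (Fin r)} (g : N) (s : mulSet f S) :
    locMap (R := R) f N φ S (LocalizedModule.mk g s) = LocalizedModule.mk (φ g) s :=
  LocalizedModule.map_mk _ _ _ _

lemma locMap_smul (φ : N →ₗ[A] N') {S : Finset (Fin r)} (x : A) (z : Loc f N S) :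
    locMap (R := R) f N φ S (x • z) = x • locMap (R := R) f N φ S z := by
  induction z using LocalizedModule.induction_on with
  | _ g s => simp only [locMap_mk, LocalizedModule.smul'_mk, map_smul]

lemma res_locMap (φ : N →ₗ[A] N') {S S' : Finset (Fin r)} (h : S ⊆ S') (z : Loc f N S) :
    res (R := R) f N' h (locMap (R := R) f N φ S z) =
      locMap (R := R) f N φ S' (res (R := R) f N h z) := by
  induction z using LocalizedModule.induction_on with
  | _ g s => simp only [res_mk, locMap_mk]

/-- The signs are taken in `A`, so that they pass through `A`-linear maps like any other scalar. -/
lemma differential_apply (σ : ∀ S : Finset (Fin r), Loc f N S) (S : Finset (Fin r)) :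
    differential (R := R) f N σ S = ∑ j ∈ S, ((-1 : A) ^ (S.filter (· < j)).card) •
      res (R := R) f N (S.erase_subset j) (σ (S.erase j)) := by
  rw [differential, LinearMap.pi_apply, LinearMap.sum_apply]
  refine Finset.sum_congr rfl fun j _ => ?_
  rw [show ((-1 : A) ^ (S.filter (· < j)).card) =
    (((-1 : ℤ) ^ (S.filter (· < j)).card : ℤ) : A) by push_cast; rfl]
  rcases neg_one_pow_eq_or ℤ (S.filter (· < j)).card with h | h <;> rw [h]
  · rw [one_smul, Int.cast_one, one_smul]; rfl
  · rw [neg_smul, one_smul, Int.cast_neg, Int.cast_one, neg_smul, one_smul]; rfl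

lemma differential_smul (x : A) (σ : ∀ S : Finset (Fin r), Loc f N S) :
    differential (R := R) f N (x • σ) = x • differential (R := R) f N σ := by
  ext S
  simp only [differential_apply, Pi.smul_apply, res_smul, Finset.smul_sum]
  exact Finset.sum_congr rfl fun j _ => smul_comm _ _ _

lemma differential_locMap (φ : N →ₗ[A] N') (σ : ∀ S : Finset (Fin r), Loc f N S) :
    differential (R := R) f N' (fun S => locMap (R := R) f N φ S (σ S)) =
      fun S => locMap (R := R) f N φ S (differential (R := R) f N σ S) := by
  ext S
  simp only [differential_apply, res_locMap, map_sum, locMap_smul]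

/-- The terms removing `j` then `k` and `k` then `j` cancel: removing the smaller index first lowers
the position of the larger by one, while the opposite order changes no position. -/
lemma differential_differential (σ : ∀ S : Finset (Fin r), Loc f N S) :
    differential (R := R) f N (differential (R := R) f N σ) = 0 := by
  ext S
  have hres : ∀ T T' : Finset (Fin r), ∀ (h : T ⊆ S) (h' : T' ⊆ S), T = T' →
      res (R := R) f N h (σ T) = res (R := R) f N h' (σ T') := by
    rintro T _ h h' rfl; rfl
  have hsub : ∀ j k : Fin r, (S.erase j).erase k ⊆ S := fun j k =>
    ((S.erase j).erase_subset k).trans (S.erase_subset j)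
  rw [differential_apply, Pi.zero_apply]
  have h1 : ∀ j ∈ S, ((-1 : A) ^ (S.filter (· < j)).card) •
      res (R := R) f N (S.erase_subset j) (differential (R := R) f N σ (S.erase j)) =
      ∑ k ∈ S.erase j, ((-1 : A) ^ (S.filter (· < j)).card *
        (-1) ^ ((S.erase j).filter (· < k)).card) •
          res (R := R) f N (hsub j k) (σ ((S.erase j).erase k)) := by
    intro j _
    rw [differential_apply, map_sum, Finset.smul_sum]
    refine Finset.sum_congr rfl fun k _ => ?_
    rw [res_smul, res_res, smul_smul]
  have hcard : ∀ j k, j ∈ S → k ∈ S → j < k →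
      ((S.erase j).filter (· < k)).card + 1 = (S.filter (· < k)).card ∧
      (S.erase k).filter (· < j) = S.filter (· < j) := by
    intro j k hj hk hjk
    constructor
    · rw [Finset.filter_erase, Finset.card_erase_add_one (by simp [hj, hjk])]
    · rw [Finset.filter_erase, Finset.erase_eq_of_notMem (by simp [hjk.le])]
  have hsign : ∀ j k, j ∈ S → k ∈ S → j ≠ k →
      (-1 : A) ^ (S.filter (· < j)).card * (-1) ^ ((S.erase j).filter (· < k)).card +
      (-1 : A) ^ (S.filter (· < k)).card * (-1) ^ ((S.erase k).filter (· < j)).card = 0 := by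
    intro j k hj hk hjk
    rcases lt_or_gt_of_ne hjk with h | h
    · obtain ⟨h2, h3⟩ := hcard j k hj hk h
      rw [h3, ← h2, pow_succ]; ring
    · obtain ⟨h2, h3⟩ := hcard k j hk hj h
      rw [h3, ← h2, pow_succ]; ring
  rw [Finset.sum_congr rfl h1, Finset.sum_sigma']
  refine Finset.sum_involution (fun p _ => ⟨p.2, p.1⟩) ?_ ?_ ?_ ?_
  · rintro ⟨j, k⟩ hp
    simp only [Finset.mem_sigma, Finset.mem_erase] at hp
    simp only
    rw [hres _ _ (hsub k j) (hsub j k) Finset.erase_right_comm, ← add_smul,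
      hsign j k hp.1 hp.2.2 (Ne.symm hp.2.1), zero_smul]
  · rintro ⟨j, k⟩ hp _ he
    simp only [Finset.mem_sigma, Finset.mem_erase] at hp
    simp only [Sigma.mk.injEq, heq_eq_eq] at he
    exact hp.2.1 he.1
  · rintro ⟨j, k⟩ hp
    simp only [Finset.mem_sigma, Finset.mem_erase] at hp ⊢
    exact ⟨hp.2.2, Ne.symm hp.2.1, hp.1⟩
  · rintro ⟨j, k⟩ hp
    rfl

end Complex

/-! ### Homogeneous cochains and reduction modulo a form -/

section Graded

variable {R A : Type*} [CommRing R] [CommRing A] [Algebra R A] {r : ℕ} {f : Fin r → A}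
variable {N : Type*} [AddCommGroup N] [Module A N] [Module R N] [IsScalarTower R A N]
variable {N' : Type*} [AddCommGroup N'] [Module A N'] [Module R N'] [IsScalarTower R A N']
variable {𝒜 : ℤ → Submodule R A} {𝒩 : ℤ → Submodule R N} {𝒩' : ℤ → Submodule R N'}

lemma pow_mem_mulSet {S : Finset (Fin r)} {j : Fin r} (hj : j ∈ S) (m : ℕ) :
    f j ^ m ∈ mulSet f S :=
  Submonoid.pow_mem _ (Submonoid.subset_closure (Set.mem_image_of_mem f hj)) m

lemma mk_mem_locPiece {S : Finset (Fin r)} {a b n : ℤ} {s : mulSet f S} {g : N}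
    (hs : (s : A) ∈ 𝒜 a) (hg : g ∈ 𝒩 b) (h : b = n + a) :
    LocalizedModule.mk g s ∈ locPiece f 𝒜 𝒩 S n :=
  Submodule.subset_span ⟨a, s, g, hs, h ▸ hg, rfl⟩

/-- Every element of `locPiece` is a single fraction of homogeneous elements. -/
lemma exists_of_mem_locPiece [SetLike.GradedMonoid 𝒜] [SetLike.GradedSMul 𝒜 𝒩]
    {S : Finset (Fin r)} {n : ℤ} {z : Loc f N S} (hz : z ∈ locPiece f 𝒜 𝒩 S n) :
    ∃ (a : ℤ) (s : mulSet f S) (g : N),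
      (s : A) ∈ 𝒜 a ∧ g ∈ 𝒩 (n + a) ∧ z = LocalizedModule.mk g s := by
  induction hz using Submodule.span_induction with
  | mem z hz => exact hz
  | zero =>
    exact ⟨0, 1, 0, SetLike.GradedOne.one_mem, zero_mem _, (LocalizedModule.zero_mk _).symm⟩
  | add z z' _ _ h h' =>
    obtain ⟨a, s, g, hs, hg, rfl⟩ := h
    obtain ⟨a', s', g', hs', hg', rfl⟩ := h'
    refine ⟨a + a', s * s', s' • g + s • g', SetLike.mul_mem_graded hs hs', add_mem ?_ ?_,
      LocalizedModule.mk_add_mk⟩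
    · have := SetLike.GradedSMul.smul_mem (B := 𝒩) hs' hg
      rwa [vadd_eq_add, show a' + (n + a) = n + (a + a') by ring] at this
    · have := SetLike.GradedSMul.smul_mem (B := 𝒩) hs hg'
      rwa [vadd_eq_add, show a + (n + a') = n + (a + a') by ring] at this
  | smul c z _ h =>
    obtain ⟨a, s, g, hs, hg, rfl⟩ := h
    exact ⟨a, s, c • g, hs, Submodule.smul_mem _ c hg, LocalizedModule.smul'_mk _ _ _⟩

lemma exists_mem_of_mem_mulSet [SetLike.GradedMonoid 𝒜] (hf : ∀ j, ∃ a, f j ∈ 𝒜 a)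
    {S : Finset (Fin r)} {s : A} (hs : s ∈ mulSet f S) : ∃ a, s ∈ 𝒜 a := by
  induction hs using Submonoid.closure_induction with
  | mem x hx =>
    obtain ⟨j, -, rfl⟩ := hx
    exact hf j
  | one => exact ⟨0, SetLike.GradedOne.one_mem⟩
  | mul x y _ _ hx hy =>
    obtain ⟨a, hx⟩ := hx
    obtain ⟨b, hy⟩ := hy
    exact ⟨a + b, SetLike.mul_mem_graded hx hy⟩

lemma res_mem_locPiece {S S' : Finset (Fin r)} (h : S ⊆ S') {n : ℤ} {z : Loc f N S}
    (hz : z ∈ locPiece f 𝒜 𝒩 S n) : res (R := R) f N h z ∈ locPiece f 𝒜 𝒩 S' n := by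
  induction hz using Submodule.span_induction with
  | mem z hz =>
    obtain ⟨a, s, g, hs, hg, rfl⟩ := hz
    rw [res_mk]
    exact mk_mem_locPiece hs hg rfl
  | zero => simp
  | add z z' _ _ h h' => rw [map_add]; exact add_mem h h'
  | smul c z _ h => rw [map_smul]; exact Submodule.smul_mem _ c h

lemma locMap_mem_locPiece (φ : N →ₗ[A] N') (hφ : ∀ n, ∀ g ∈ 𝒩 n, φ g ∈ 𝒩' n)
    {S : Finset (Fin r)} {n : ℤ} {z : Loc f N S}
    (hz : z ∈ locPiece f 𝒜 𝒩 S n) : locMap (R := R) f N φ S z ∈ locPiece f 𝒜 𝒩' S n := by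
  induction hz using Submodule.span_induction with
  | mem z hz =>
    obtain ⟨a, s, g, hs, hg, rfl⟩ := hz
    rw [locMap_mk]
    exact mk_mem_locPiece hs (hφ _ _ hg) rfl
  | zero => simp
  | add z z' _ _ h h' => rw [map_add]; exact add_mem h h'
  | smul c z _ h => rw [map_smul]; exact Submodule.smul_mem _ c h

lemma smul_mem_locPiece [SetLike.GradedSMul 𝒜 𝒩] {b : ℤ} {x : A} (hx : x ∈ 𝒜 b)
    {S : Finset (Fin r)} {n m : ℤ} (hm : b + n = m) {z : Loc f N S}
    (hz : z ∈ locPiece f 𝒜 𝒩 S n) : x • z ∈ locPiece f 𝒜 𝒩 S m := by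
  induction hz using Submodule.span_induction with
  | mem z hz =>
    obtain ⟨a, s, g, hs, hg, rfl⟩ := hz
    rw [LocalizedModule.smul'_mk]
    exact mk_mem_locPiece hs (SetLike.GradedSMul.smul_mem hx hg) (by rw [vadd_eq_add]; omega)
  | zero => simp
  | add z z' _ _ h h' => rw [smul_add]; exact add_mem h h'
  | smul c z _ h => rw [smul_comm]; exact Submodule.smul_mem _ c h

lemma exists_locMap_eq [SetLike.GradedMonoid 𝒜] [SetLike.GradedSMul 𝒜 𝒩']
    (φ : N →ₗ[A] N') (hφ : ∀ n, ∀ g ∈ 𝒩' n, ∃ g' ∈ 𝒩 n, φ g' = g)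
    {S : Finset (Fin r)} {n : ℤ} {z : Loc f N' S} (hz : z ∈ locPiece f 𝒜 𝒩' S n) :
    ∃ w ∈ locPiece f 𝒜 𝒩 S n, locMap (R := R) f N φ S w = z := by
  obtain ⟨a, s, g, hs, hg, rfl⟩ := exists_of_mem_locPiece hz
  obtain ⟨g', hg', rfl⟩ := hφ _ g hg
  exact ⟨LocalizedModule.mk g' s, mk_mem_locPiece hs hg' rfl, locMap_mk _ _ _ _⟩

/-- If homogeneous elements in the kernel of `φ` are divisible by the form `x`, then so are
homogeneous elements of the kernel of the localization of `φ`. -/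
lemma exists_smul_eq_of_locMap_eq_zero [SetLike.GradedMonoid 𝒜] [SetLike.GradedSMul 𝒜 𝒩]
    (hf : ∀ j, ∃ a, f j ∈ 𝒜 a) (φ : N →ₗ[A] N') {x : A} {b : ℤ}
    (hφ : ∀ n, ∀ g ∈ 𝒩 n, φ g = 0 → ∃ g' ∈ 𝒩 (n - b), x • g' = g)
    {S : Finset (Fin r)} {n : ℤ} {z : Loc f N S} (hz : z ∈ locPiece f 𝒜 𝒩 S n)
    (h0 : locMap (R := R) f N φ S z = 0) :
    ∃ w ∈ locPiece f 𝒜 𝒩 S (n - b), x • w = z := by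
  obtain ⟨a, s, g, hs, hg, rfl⟩ := exists_of_mem_locPiece hz
  rw [locMap_mk, IsLocalizedModule.mk_eq_mk', IsLocalizedModule.mk'_eq_zero'] at h0
  -- The multiplier `u` is a product of the `f j`, hence homogeneous; thus `u • g` is a homogeneous
  -- element of the kernel and is divisible by `x`.
  obtain ⟨u, hu⟩ := h0
  obtain ⟨c, hc⟩ := exists_mem_of_mem_mulSet hf u.2
  have hug := SetLike.GradedSMul.smul_mem (B := 𝒩) hc hg
  obtain ⟨g', hg', hxg⟩ := hφ _ _ hug (by rw [map_smul]; exact hu)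
  refine ⟨LocalizedModule.mk g' (u * s), mk_mem_locPiece (SetLike.mul_mem_graded hc hs) hg'
    (by rw [vadd_eq_add]; ring), ?_⟩
  rw [LocalizedModule.smul'_mk, hxg]
  exact LocalizedModule.mk_cancel_common_left u s g

lemma differential_mem_cochains {p : ℕ} {n : ℤ} {σ : ∀ S : Finset (Fin r), Loc f N S}
    (hσ : σ ∈ cochains f 𝒜 𝒩 p n) :
    differential (R := R) f N σ ∈ cochains f 𝒜 𝒩 (p + 1) n := by
  intro S
  rw [differential_apply]
  refine ⟨sum_mem fun j _ => ?_, fun hS => ?_⟩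
  · have hres := res_mem_locPiece (S.erase_subset j) (hσ (S.erase j)).1
    rcases neg_one_pow_eq_or A (S.filter (· < j)).card with h | h <;> rw [h]
    · rwa [one_smul]
    · rw [neg_smul, one_smul]
      exact neg_mem hres
  refine Finset.sum_eq_zero fun j hj => ?_
  rw [(hσ (S.erase j)).2, map_zero, smul_zero]
  rw [Finset.card_erase_of_mem hj]
  have := Finset.card_pos.mpr ⟨j, hj⟩
  omega

variable (f 𝒜 𝒩) in
lemma subsingleton_cohomology_iff (p : ℕ) (n : ℤ) :
    Subsingleton (cohomology f 𝒜 𝒩 p n) ↔ cocycles f 𝒜 𝒩 p n ≤ coboundaries f 𝒜 𝒩 p n := by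
  rw [Submodule.Quotient.subsingleton_iff, Submodule.submoduleOf,
    Submodule.comap_subtype_eq_top]

/-- The part of the long exact sequence of multiplication by a form `x` that is injective on all
localizations: `Hᵖ(N)ₙ = 0` and `Hᵖ⁺¹(N)ₙ₋ₐ = 0` imply `Hᵖ(N / x N)ₙ = 0`. -/
lemma cocycles_le_coboundaries_of_quotient [SetLike.GradedMonoid 𝒜] [SetLike.GradedSMul 𝒜 𝒩]
    [SetLike.GradedSMul 𝒜 𝒩'] (hf : ∀ j, ∃ a, f j ∈ 𝒜 a) (φ : N →ₗ[A] N') {x : A} {b : ℤ}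
    (hx : x ∈ 𝒜 b) (hφx : ∀ g, φ (x • g) = 0)
    (hφmap : ∀ n, ∀ g ∈ 𝒩 n, φ g ∈ 𝒩' n)
    (hφlift : ∀ n, ∀ g ∈ 𝒩' n, ∃ g' ∈ 𝒩 n, φ g' = g)
    (hφker : ∀ n, ∀ g ∈ 𝒩 n, φ g = 0 → ∃ g' ∈ 𝒩 (n - b), x • g' = g)
    (hinj : ∀ S : Finset (Fin r), S.Nonempty → ∀ z : Loc f N S, x • z = 0 → z = 0)
    {p : ℕ} {n : ℤ} (h0 : cocycles f 𝒜 𝒩 p n ≤ coboundaries f 𝒜 𝒩 p n)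
    (h1 : cocycles f 𝒜 𝒩 (p + 1) (n - b) ≤ coboundaries f 𝒜 𝒩 (p + 1) (n - b)) :
    cocycles f 𝒜 𝒩' p n ≤ coboundaries f 𝒜 𝒩' p n := by
  intro σ' hσ'
  obtain ⟨hσ'c, hσ'd⟩ := hσ'
  -- The connecting homomorphism by hand: lift `σ'` to `σ`, write `dσ = x τ` and `τ = dρ`. Then `σ -
  -- x ρ` is a cocycle lifting `σ'`, hence a coboundary.
  have hσ : ∀ S, ∃ w : Loc f N S, w ∈ locPiece f 𝒜 𝒩 S n ∧ (S.card ≠ p → w = 0) ∧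
      locMap (R := R) f N φ S w = σ' S := by
    intro S
    by_cases hS : S.card = p
    · obtain ⟨w, hw, hwz⟩ := exists_locMap_eq φ hφlift (hσ'c S).1
      exact ⟨w, hw, fun h => absurd hS h, hwz⟩
    · exact ⟨0, zero_mem _, fun _ => rfl, by rw [map_zero, (hσ'c S).2 hS]⟩
  choose σ hσ1 hσ2 hσ3 using hσ
  have hσc : σ ∈ cochains f 𝒜 𝒩 p n := fun S => ⟨hσ1 S, hσ2 S⟩
  have hσeq : (fun S => locMap (R := R) f N φ S (σ S)) = σ' := funext hσ3
  have hdσ := differential_mem_cochains hσc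
  have hdσ0 : ∀ S, locMap (R := R) f N φ S (differential (R := R) f N σ S) = 0 := by
    intro S
    have := congrFun (differential_locMap (R := R) f φ σ) S
    rw [hσeq, LinearMap.mem_ker.mp hσ'd] at this
    exact this.symm
  have hτ : ∀ S, ∃ w : Loc f N S, w ∈ locPiece f 𝒜 𝒩 S (n - b) ∧ (S.card ≠ p + 1 → w = 0) ∧
      x • w = differential (R := R) f N σ S := by
    intro S
    by_cases hS : S.card = p + 1
    · obtain ⟨w, hw, hwz⟩ := exists_smul_eq_of_locMap_eq_zero hf φ hφker (hdσ S).1 (hdσ0 S)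
      exact ⟨w, hw, fun h => absurd hS h, hwz⟩
    · exact ⟨0, zero_mem _, fun _ => rfl, by rw [smul_zero, (hdσ S).2 hS]⟩
  choose τ hτ1 hτ2 hτ3 using hτ
  have hτc : τ ∈ cochains f 𝒜 𝒩 (p + 1) (n - b) := fun S => ⟨hτ1 S, hτ2 S⟩
  have hxτ : x • τ = differential (R := R) f N σ := funext hτ3
  have hdτ : differential (R := R) f N τ = 0 := by
    ext S
    -- On `N` itself `x` may fail to be injective, but `dτ` at `∅` is an empty sum.
    rcases S.eq_empty_or_nonempty with rfl | hS
    · simp [differential_apply]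
    · refine hinj S hS _ ?_
      have := differential_smul (R := R) f x τ
      rw [hxτ, differential_differential] at this
      exact (congrFun this S).symm
  obtain ⟨ρ, hρ, hρτ⟩ := h1 ⟨hτc, LinearMap.mem_ker.mpr hdτ⟩
  have hxρ : x • ρ ∈ cochains f 𝒜 𝒩 p n := fun S =>
    ⟨smul_mem_locPiece hx (by ring) (hρ S).1, fun h => by simp [(hρ S).2 h]⟩
  have hcoc : σ - x • ρ ∈ cocycles f 𝒜 𝒩 p n := by
    refine ⟨sub_mem hσc hxρ, LinearMap.mem_ker.mpr ?_⟩
    rw [map_sub, differential_smul, hρτ, hxτ, sub_self]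
  have hmap : (fun S => locMap (R := R) f N φ S ((σ - x • ρ) S)) = σ' := by
    rw [← hσeq]
    ext S
    rw [Pi.sub_apply, map_sub, sub_eq_self, Pi.smul_apply]
    generalize ρ S = z
    induction z using LocalizedModule.induction_on with
    | _ g s => rw [LocalizedModule.smul'_mk, locMap_mk, hφx, LocalizedModule.zero_mk]
  have hcob := h0 hcoc
  rw [← hmap]
  cases p with
  | zero =>
    rw [show σ - x • ρ = 0 from hcob]
    simp only [Pi.zero_apply, map_zero]
    exact zero_mem _
  | succ q =>
    obtain ⟨π, hπ, hπd⟩ := hcob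
    refine ⟨fun S => locMap (R := R) f N φ S (π S), fun S =>
      ⟨locMap_mem_locPiece φ hφmap (hπ S).1, fun h => by simp only [(hπ S).2 h, map_zero]⟩, ?_⟩
    rw [differential_locMap, hπd]

/-- If `H⁰(N)ₙ = 0`, then an element of `Nₙ` is zero if it vanishes in all localizations. -/
lemma eq_zero_of_forall_smul_eq_zero [SetLike.GradedMonoid 𝒜] {n : ℤ}
    (h0 : cocycles f 𝒜 𝒩 0 n ≤ coboundaries f 𝒜 𝒩 0 n) {g : N} (hg : g ∈ 𝒩 n)
    (htors : ∀ j, ∃ m : ℕ, f j ^ m • g = 0) : g = 0 := by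
  -- At `∅` only `1` is inverted, so `g` is a cochain there; it is a cocycle because it dies in
  -- every further localization.
  set σ : ∀ S : Finset (Fin r), Loc f N S :=
    fun S => if S = ∅ then LocalizedModule.mk g 1 else 0 with hσ
  have hmem : σ ∈ cocycles f 𝒜 𝒩 0 n := by
    refine ⟨fun S => ⟨?_, fun hS => ?_⟩, LinearMap.mem_ker.mpr ?_⟩
    · rw [hσ]
      dsimp only
      split_ifs with h
      · exact mk_mem_locPiece SetLike.GradedOne.one_mem hg (by ring)
      · exact zero_mem _
    · simp only [hσ]
      rw [if_neg (by rintro rfl; simp at hS)]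
    · ext S
      rw [differential_apply, Pi.zero_apply]
      refine Finset.sum_eq_zero fun j hj => ?_
      have : res (R := R) f N (S.erase_subset j) (σ (S.erase j)) = 0 := by
        simp only [hσ]
        split_ifs with h
        · rw [res_mk, IsLocalizedModule.mk_eq_mk', IsLocalizedModule.mk'_eq_zero']
          obtain ⟨m, hm⟩ := htors j
          exact ⟨⟨f j ^ m, pow_mem_mulSet hj m⟩, hm⟩
        · rw [map_zero]
      rw [this, smul_zero]
  have h : σ = 0 := h0 hmem
  have h2 := congrFun h ∅
  simp only [hσ, if_true, Pi.zero_apply] at h2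
  rw [IsLocalizedModule.mk_eq_mk', IsLocalizedModule.mk'_eq_zero'] at h2
  obtain ⟨u, hu⟩ := h2
  have hu1 : (u : A) = 1 := by
    have := u.2
    simpa [mulSet] using this
  rwa [Submonoid.smul_def, hu1, one_smul] at hu

/-- If the kernel of multiplication by `x` on `N` is killed by powers of each `f j`, then `x` acts
injectively on the nontrivial localizations. -/
lemma eq_zero_of_smul_eq_zero_of_forall {x : A}
    (hx : ∀ g : N, x • g = 0 → ∀ j, ∃ m : ℕ, f j ^ m • g = 0)
    (S : Finset (Fin r)) (hS : S.Nonempty) (z : Loc f N S) (hz : x • z = 0) : z = 0 := by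
  induction z using LocalizedModule.induction_on with
  | _ g s =>
  obtain ⟨j, hj⟩ := hS
  rw [LocalizedModule.smul'_mk, IsLocalizedModule.mk_eq_mk', IsLocalizedModule.mk'_eq_zero'] at hz
  obtain ⟨u, hu⟩ := hz
  obtain ⟨m, hm⟩ := hx (u • g) (by rw [smul_comm]; exact hu) j
  rw [IsLocalizedModule.mk_eq_mk', IsLocalizedModule.mk'_eq_zero']
  refine ⟨(⟨f j ^ m, pow_mem_mulSet hj m⟩ : mulSet f S) * u, ?_⟩
  rw [mul_smul]
  exact hm

end Graded

end GradedCech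

/-! ### Hilbert functions of cyclic graded modules -/

/-! ### Torsion with respect to `M` and filter-regular elements -/

section Torsion

variable {A : Type*} [CommRing A] (M : Ideal A) (N : Type*) [AddCommGroup N] [Module A N]

/-- In a Noetherian module, all elements killed by a power of `M` are killed by the same power. -/
lemma exists_torsionBySet_pow_stable [IsNoetherian A N] :
    ∃ s₀ : ℕ, ∀ s, Submodule.torsionBySet A N (M ^ s : Ideal A) ≤
      Submodule.torsionBySet A N (M ^ s₀ : Ideal A) := by
  let Γ : ℕ →o Submodule A N :=
    ⟨fun s => Submodule.torsionBySet A N (M ^ s : Ideal A), fun s t hst =>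
      Submodule.torsionBySet_le_torsionBySet_of_subset (Ideal.pow_le_pow_right hst)⟩
  obtain ⟨s₀, h⟩ := monotone_stabilizes_iff_noetherian.mpr ‹_› Γ
  refine ⟨s₀, fun s => ?_⟩
  rcases le_total s s₀ with hs | hs
  · exact Γ.monotone hs
  · exact (h s hs).ge

variable {M N}

/-- An element outside the associated primes of the quotient of `N` by its torsion is filter-regular
on `N`. -/
lemma exists_filterRegular [IsNoetherianRing A] [IsNoetherian A N] {s₀ : ℕ}
    (hs₀ : ∀ s, Submodule.torsionBySet A N (M ^ s : Ideal A) ≤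
      Submodule.torsionBySet A N (M ^ s₀ : Ideal A)) (X : Set A)
    (hX : ∀ T : Set (Ideal A), T.Finite → (∀ P ∈ T, P.IsPrime ∧ ¬ M ≤ P) →
      ∃ x ∈ X, ∀ P ∈ T, x ∉ P) :
    ∃ x ∈ X, ∀ y : N, x • y = 0 → y ∈ Submodule.torsionBySet A N (M ^ s₀ : Ideal A) := by
  set Γ := Submodule.torsionBySet A N (M ^ s₀ : Ideal A) with hΓ
  obtain ⟨x, hxX, hx⟩ := hX (associatedPrimes A (N ⧸ Γ)) (associatedPrimes.finite A (N ⧸ Γ)) (by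
    intro P hP
    rw [AssociatedPrimes.mem_iff, isAssociatedPrime_iff] at hP
    obtain ⟨hprime, q, rfl⟩ := hP
    -- If `M` killed the class of `y`, then `M ^ (s₀ + 1)` would kill `y`; by stability `y ∈ Γ`, so
    -- the class would be zero.
    refine ⟨hprime, fun hM => hprime.ne_top ?_⟩
    obtain ⟨y, rfl⟩ := Submodule.mkQ_surjective Γ q
    have hy : y ∈ Γ := by
      refine hs₀ (s₀ + 1) ?_
      rw [Submodule.mem_torsionBySet_iff]
      rintro ⟨c, hc⟩
      have hle : M ^ (s₀ + 1) ≤ (⊥ : Submodule A N).colon {y} := by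
        rw [pow_succ, Ideal.mul_le]
        intro a ha b hb
        have h1 := hM hb
        rw [Submodule.mem_colon_singleton, Submodule.mem_bot, ← map_smul, Submodule.mkQ_apply,
          Submodule.Quotient.mk_eq_zero, hΓ, Submodule.mem_torsionBySet_iff] at h1
        rw [Submodule.mem_colon_singleton, Submodule.mem_bot, mul_smul]
        exact h1 ⟨a, ha⟩
      have h2 := hle hc
      rwa [Submodule.mem_colon_singleton, Submodule.mem_bot] at h2
    rw [Ideal.eq_top_iff_one, Submodule.mem_colon_singleton, Submodule.mem_bot, one_smul]
    exact (Submodule.Quotient.mk_eq_zero Γ).mpr hy)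
  refine ⟨x, hxX, fun y hy => ?_⟩
  by_contra hyΓ
  have hmem : x ∈ ⋃ p ∈ associatedPrimes A (N ⧸ Γ), (p : Set A) := by
    rw [biUnion_associatedPrimes_eq_zero_divisors]
    refine ⟨Submodule.Quotient.mk y, fun h => hyΓ ((Submodule.Quotient.mk_eq_zero Γ).mp h), ?_⟩
    rw [← Submodule.Quotient.mk_smul, hy, Submodule.Quotient.mk_zero]
  simp only [Set.mem_iUnion] at hmem
  obtain ⟨P, hP, hxP⟩ := hmem
  exact hx P hP hxP

/-- By the Artin-Rees lemma, the torsion meets `Mⁿ N` trivially for large `n`. -/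
lemma exists_pow_smul_inf_torsion_eq_bot [IsNoetherianRing A] [Module.Finite A N] (s₀ : ℕ) :
    ∃ s : ℕ, (M ^ s • ⊤ : Submodule A N) ⊓ Submodule.torsionBySet A N (M ^ s₀ : Ideal A) = ⊥ := by
  obtain ⟨k, hk⟩ := M.exists_pow_inf_eq_pow_smul (Submodule.torsionBySet A N (M ^ s₀ : Ideal A))
  -- The intersection becomes `M ^ s₀` times a submodule of the torsion, which is zero.
  refine ⟨k + s₀, ?_⟩
  rw [hk _ (Nat.le_add_right k s₀), Nat.add_sub_cancel_left, eq_bot_iff, Submodule.smul_le]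
  rintro c hc y ⟨-, hy⟩
  exact (Submodule.mem_torsionBySet_iff _ _).mp hy ⟨c, hc⟩

end Torsion

/-! ### Cutting a graded cyclic module by linear forms -/

section Graded

universe u v

variable {R : Type v} {A : Type u} [CommRing R] [CommRing A] [Algebra R A]

/-- A graded algebra with components of finite length, in which the components of large degree lie
in large powers of the ideal `M`, and forms of degree `1` avoid finitely many primes that do not
contain `M`. The maps `pr n` are the projections onto the components. -/
structure IsGradedWithLinearForms (𝒜 : ℤ → Submodule R A) (pr : ℤ → A →ₗ[R] A) (M : Ideal A) :
    Prop where
  one_mem : (1 : A) ∈ 𝒜 0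
  mul_mem : ∀ {m n : ℤ} {a b : A}, a ∈ 𝒜 m → b ∈ 𝒜 n → a * b ∈ 𝒜 (m + n)
  pr_mem : ∀ n a, pr n a ∈ 𝒜 n
  pr_self : ∀ n, ∀ a ∈ 𝒜 n, pr n a = a
  pr_mul : ∀ n, ∀ x ∈ 𝒜 1, ∀ a, pr n (x * a) = x * pr (n - 1) a
  length_ne_top : ∀ n, Module.length R (𝒜 n) ≠ ⊤
  exists_le_pow : ∀ s : ℕ, ∃ n₀ : ℤ, ∀ n ≥ n₀, ∀ a ∈ 𝒜 n, a ∈ M ^ s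
  exists_avoiding : ∀ T : Set (Ideal A), T.Finite → (∀ P ∈ T, P.IsPrime ∧ ¬ M ≤ P) →
    ∃ x ∈ 𝒜 1, ∀ P ∈ T, x ∉ P

variable {N : Type*} [AddCommGroup N] [Module A N] [Module R N] [IsScalarTower R A N]

/-- The grading on the image of a linear map. -/
def imagePiece (𝒜 : ℤ → Submodule R A) (π : A →ₗ[A] N) (n : ℤ) : Submodule R N :=
  (𝒜 n).map (π.restrictScalars R)

/-- The Hilbert function of the image of a linear map. -/
def imageHilbert (𝒜 : ℤ → Submodule R A) (π : A →ₗ[A] N) (n : ℤ) : ℤ :=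
  (Module.length R (imagePiece 𝒜 π n)).toNat

variable {𝒜 : ℤ → Submodule R A} {pr : ℤ → A →ₗ[R] A} {M : Ideal A} {π : A →ₗ[A] N}

lemma imageHilbert_nonneg (n : ℤ) : 0 ≤ imageHilbert 𝒜 π n := Int.natCast_nonneg _

namespace IsGradedWithLinearForms

variable (hA : IsGradedWithLinearForms 𝒜 pr M)

include hA

lemma gradedMonoid : SetLike.GradedMonoid 𝒜 where
  one_mem := hA.one_mem
  mul_mem _ _ _ _ ha hb := hA.mul_mem ha hb

lemma gradedSMul (π : A →ₗ[A] N) : SetLike.GradedSMul 𝒜 (imagePiece 𝒜 π) where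
  smul_mem := by
    rintro i j a _ ha ⟨b, hb, rfl⟩
    exact ⟨a * b, hA.mul_mem ha hb, by simp [← smul_eq_mul]⟩

lemma length_imagePiece_ne_top (π : A →ₗ[A] N) (n : ℤ) :
    Module.length R (imagePiece 𝒜 π n) ≠ ⊤ := by
  refine ne_top_of_le_ne_top (hA.length_ne_top n) ?_
  exact Module.length_le_of_surjective ((π.restrictScalars R).submoduleMap (𝒜 n))
    (LinearMap.submoduleMap_surjective _ _)

omit hA in
lemma imageHilbert_eq_zero {n : ℤ} (h : ∀ y ∈ imagePiece 𝒜 π n, y = 0) :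
    imageHilbert 𝒜 π n = 0 := by
  have : Subsingleton (imagePiece 𝒜 π n) :=
    ⟨fun a b => Subtype.ext ((h _ a.2).trans (h _ b.2).symm)⟩
  simp [imageHilbert]

variable {x : A} (hx : x ∈ 𝒜 1) (hpr : ∀ n, ∀ a ∈ LinearMap.ker π, pr n a ∈ LinearMap.ker π)

include hx hpr

/-- A homogeneous element that vanishes in `N / x N` is divisible by `x`. -/
lemma exists_smul_eq_of_mkQ_eq_zero {n : ℤ} {y : N} (hy : y ∈ imagePiece 𝒜 π n)
    (h0 : (Submodule.span A {x • π 1}).mkQ y = 0) : ∃ z ∈ imagePiece 𝒜 π (n - 1), x • z = y := by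
  obtain ⟨b, hb, rfl⟩ := hy
  rw [Submodule.mkQ_apply, Submodule.Quotient.mk_eq_zero, Submodule.mem_span_singleton] at h0
  obtain ⟨c, hc⟩ := h0
  have hker : b - x * c ∈ LinearMap.ker π := by
    rw [LinearMap.mem_ker, map_sub, sub_eq_zero]
    refine Eq.trans hc.symm ?_
    rw [← map_smul, ← map_smul, smul_eq_mul, smul_eq_mul, mul_one, mul_comm]
  -- The kernel of `π` is homogeneous, so the degree-`n` part of `b - x * c` lies in it as well;
  -- this replaces `c` by a homogeneous element.
  have h1 := hpr n _ hker
  rw [map_sub, hA.pr_self n b hb, hA.pr_mul n x hx, LinearMap.mem_ker, map_sub, sub_eq_zero] at h1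
  refine ⟨π (pr (n - 1) c), ⟨_, hA.pr_mem _ _, rfl⟩, ?_⟩
  rw [← map_smul]
  exact h1.symm

/-- The Hilbert function of `N / x N`. -/
lemma imageHilbert_sub_imageHilbert {n : ℤ}
    (hinj : ∀ y ∈ imagePiece 𝒜 π (n - 1), x • y = 0 → y = 0) :
    imageHilbert 𝒜 π n - imageHilbert 𝒜 π (n - 1) =
      imageHilbert 𝒜 ((Submodule.span A {x • π 1}).mkQ ∘ₗ π) n := by
  set φ := (Submodule.span A {x • π 1}).mkQ with hφ
  let g₁ : imagePiece 𝒜 π (n - 1) →ₗ[R] imagePiece 𝒜 π n :=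
    ((LinearMap.lsmul A N x).restrictScalars R).restrict (by
      rintro _ ⟨b, hb, rfl⟩
      have := hA.mul_mem hx hb
      rw [add_sub_cancel] at this
      exact ⟨x * b, this, by simp [← smul_eq_mul]⟩)
  let g₂ : imagePiece 𝒜 π n →ₗ[R] imagePiece 𝒜 (φ ∘ₗ π) n :=
    (φ.restrictScalars R).restrict (by
      rintro _ ⟨b, hb, rfl⟩
      exact ⟨b, hb, rfl⟩)
  have h₁ : Function.Injective g₁ := by
    rw [injective_iff_map_eq_zero]
    rintro ⟨y, hy⟩ h
    exact Subtype.ext (hinj y hy (congrArg Subtype.val h))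
  have h₂ : Function.Surjective g₂ := by
    rintro ⟨_, b, hb, rfl⟩
    exact ⟨⟨π b, b, hb, rfl⟩, rfl⟩
  have h₃ : Function.Exact g₁ g₂ := by
    rintro ⟨y, hy⟩
    constructor
    · intro h
      obtain ⟨z, hz, rfl⟩ := hA.exists_smul_eq_of_mkQ_eq_zero hx hpr hy (congrArg Subtype.val h)
      exact ⟨⟨z, hz⟩, rfl⟩
    · rintro ⟨⟨_, b, hb, rfl⟩, h⟩
      refine Subtype.ext ?_
      have h' : x • π b = y := congrArg Subtype.val h
      change φ y = 0
      rw [← h', hφ, Submodule.mkQ_apply, Submodule.Quotient.mk_eq_zero,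
        Submodule.mem_span_singleton]
      exact ⟨b, by rw [← map_smul, ← map_smul, ← map_smul]; simp [mul_comm]⟩
  have hlen := Module.length_eq_add_of_exact g₁ g₂ h₁ h₂ h₃
  have hlen' : (Module.length R (imagePiece 𝒜 π n)).toNat =
      (Module.length R (imagePiece 𝒜 π (n - 1))).toNat +
        (Module.length R (imagePiece 𝒜 (φ ∘ₗ π) n)).toNat := by
    rw [hlen, ENat.toNat_add (hA.length_imagePiece_ne_top _ _) (hA.length_imagePiece_ne_top _ _)]
  simp only [imageHilbert, hlen']
  push_cast
  ring

end IsGradedWithLinearForms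

open GradedCech in
/-- The Hilbert function of a graded quotient `N` of `A` is eventually a polynomial, and agrees with
it in degrees `≥ l` if `Hⁱ(N)ₙ = 0` for all `n ≥ l` and all `i` up to one more than the degree of
the polynomial. -/
theorem IsGradedWithLinearForms.exists_hilbertPolynomial [IsNoetherianRing A]
    (hA : IsGradedWithLinearForms 𝒜 pr M) {r : ℕ} {f : Fin r → A} (hf : ∀ j, ∃ a, f j ∈ 𝒜 a)
    (hfM : ∀ j, f j ∈ M.radical) (𝔞 : Ideal A) :
    ∀ (N : Type u) [AddCommGroup N] [Module A N] [Module R N] [IsScalarTower R A N]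
      (π : A →ₗ[A] N), Function.Surjective π → LinearMap.ker π = 𝔞 →
      (∀ n, ∀ a ∈ LinearMap.ker π, pr n a ∈ LinearMap.ker π) →
      ∃ P : ℤ → ℤ, (∃ k, IsNumPoly k P) ∧ (∃ n₀, ∀ n ≥ n₀, imageHilbert 𝒜 π n = P n) ∧
        ∀ (e : ℕ) (l : ℤ), IsNumPoly e P →
          (∀ i ≤ e, ∀ n ≥ l, cocycles f 𝒜 (imagePiece 𝒜 π) i n ≤
            coboundaries f 𝒜 (imagePiece 𝒜 π) i n) →
          ∀ n ≥ l, imageHilbert 𝒜 π n = P n := by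
  have := hA.gradedMonoid
  induction 𝔞 using IsNoetherian.induction with
  | hgt 𝔞 ih =>
  intro N _ _ _ _ π hπ hker hpr
  have := hA.gradedSMul π
  have : Module.Finite A N := Module.Finite.of_surjective π hπ
  obtain ⟨s₀, hs₀⟩ := exists_torsionBySet_pow_stable M N
  set Γ := Submodule.torsionBySet A N (M ^ s₀ : Ideal A) with hΓ
  have hΓf : ∀ y ∈ Γ, ∀ j, ∃ m : ℕ, f j ^ m • y = 0 := by
    intro y hy j
    obtain ⟨m, hm⟩ := hfM j
    refine ⟨m * s₀, ?_⟩
    rw [pow_mul]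
    exact (Submodule.mem_torsionBySet_iff _ _).mp hy ⟨_, Ideal.pow_mem_pow hm s₀⟩
  obtain ⟨s₁, hs₁⟩ := exists_pow_smul_inf_torsion_eq_bot (M := M) (N := N) s₀
  obtain ⟨n₁, hn₁⟩ := hA.exists_le_pow s₁
  have hΓlarge : ∀ n ≥ n₁, ∀ y ∈ imagePiece 𝒜 π n, y ∈ Γ → y = 0 := by
    rintro n hn _ ⟨a, ha, rfl⟩ hy
    have h1 : π a ∈ (M ^ s₁ • ⊤ : Submodule A N) := by
      have h2 : a • π 1 ∈ (M ^ s₁ • ⊤ : Submodule A N) :=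
        Submodule.smul_mem_smul (hn₁ n hn a ha) trivial
      rwa [← map_smul, smul_eq_mul, mul_one] at h2
    have h3 : π a ∈ (⊥ : Submodule A N) := hs₁ ▸ ⟨h1, hy⟩
    exact h3
  have hΓ0 : ∀ n, cocycles f 𝒜 (imagePiece 𝒜 π) 0 n ≤ coboundaries f 𝒜 (imagePiece 𝒜 π) 0 n →
      ∀ y ∈ imagePiece 𝒜 π n, y ∈ Γ → y = 0 := fun n h0 y hy hyΓ =>
    eq_zero_of_forall_smul_eq_zero h0 hy (hΓf y hyΓ)
  -- If the generator is torsion, so is all of `N`, and the Hilbert polynomial is `0`. Otherwise a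
  -- filter-regular `x` cannot lie in `𝔞`, so `N / x N` has a strictly larger annihilator.
  by_cases htop : π 1 ∈ Γ
  · have hall : ∀ y : N, y ∈ Γ := by
      intro y
      obtain ⟨a, rfl⟩ := hπ y
      have := Γ.smul_mem a htop
      rwa [← map_smul, smul_eq_mul, mul_one] at this
    refine ⟨0, ⟨0, IsNumPoly.zero 0⟩, ⟨n₁, fun n hn => ?_⟩, fun e l _ hH n hn => ?_⟩
    · exact imageHilbert_eq_zero fun y hy => hΓlarge n hn y hy (hall y)
    · exact imageHilbert_eq_zero fun y hy => hΓ0 n (hH 0 (Nat.zero_le e) n hn) y hy (hall y)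
  obtain ⟨x, hx, hxreg⟩ := exists_filterRegular hs₀ (𝒜 1 : Set A) hA.exists_avoiding
  set φ := (Submodule.span A {x • π 1}).mkQ with hφ
  have := hA.gradedSMul (φ ∘ₗ π)
  have hφx : ∀ g, φ (x • g) = 0 := by
    intro g
    obtain ⟨a, rfl⟩ := hπ g
    rw [hφ, Submodule.mkQ_apply, Submodule.Quotient.mk_eq_zero, Submodule.mem_span_singleton]
    exact ⟨a, by rw [← map_smul, ← map_smul, ← map_smul]; simp [mul_comm]⟩
  have hker' : LinearMap.ker (φ ∘ₗ π) = 𝔞 ⊔ Ideal.span {x} := by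
    rw [LinearMap.ker_comp, hφ, Submodule.ker_mkQ, ← hker, sup_comm, ← map_smul, smul_eq_mul,
      mul_one, ← Set.image_singleton, ← Submodule.map_span]
    exact Submodule.comap_map_eq _ _
  have hlt : 𝔞 < 𝔞 ⊔ Ideal.span {x} := by
    refine lt_of_le_of_ne le_sup_left fun h => htop (hxreg _ ?_)
    have hx𝔞 : x ∈ 𝔞 := h ▸ Ideal.mem_sup_right (Ideal.mem_span_singleton_self x)
    rw [← hker, LinearMap.mem_ker] at hx𝔞
    rw [← map_smul, smul_eq_mul, mul_one, hx𝔞]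
  have hpr' : ∀ n, ∀ a ∈ LinearMap.ker (φ ∘ₗ π), pr n a ∈ LinearMap.ker (φ ∘ₗ π) := by
    intro n a ha
    rw [hker'] at ha ⊢
    obtain ⟨a₀, ha₀, b, hb, rfl⟩ := Submodule.mem_sup.mp ha
    obtain ⟨c, rfl⟩ := Ideal.mem_span_singleton'.mp hb
    rw [map_add, mul_comm c x, hA.pr_mul n x hx]
    exact add_mem (Ideal.mem_sup_left (hker ▸ hpr n a₀ (hker ▸ ha₀)))
      (Ideal.mem_sup_right (Ideal.mul_mem_right _ _ (Ideal.mem_span_singleton_self x)))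
  obtain ⟨P'', ⟨k, hk⟩, ⟨n₂, hn₂⟩, hP''⟩ := ih _ hlt (N ⧸ Submodule.span A {x • π 1})
    (φ ∘ₗ π) ((Submodule.mkQ_surjective _).comp hπ) hker' hpr'
  have hdiff : ∀ n, (∀ y ∈ imagePiece 𝒜 π (n - 1), y ∈ Γ → y = 0) →
      imageHilbert 𝒜 π n - imageHilbert 𝒜 π (n - 1) = imageHilbert 𝒜 (φ ∘ₗ π) n := fun n hn =>
    hA.imageHilbert_sub_imageHilbert hx hpr fun y hy h => hn y hy (hxreg y h)
  set n₃ := max n₁ n₂ with hn₃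
  obtain ⟨P, hPk, hPdiff, hPn₃⟩ := hk.exists_antidifference n₃ (imageHilbert 𝒜 π n₃)
  have heq : ∀ n ≥ n₃, imageHilbert 𝒜 π n = P n := by
    intro n hn
    induction n, hn using Int.leInduction with
    | base => exact hPn₃.symm
    | succ n hn hi =>
      have h1 := hdiff (n + 1) (by
        rw [add_sub_cancel_right]
        exact hΓlarge n ((le_max_left _ _).trans hn))
      have h2 := hPdiff (n + 1)
      rw [add_sub_cancel_right] at h1 h2
      rw [hn₂ (n + 1) (by have := le_max_right n₁ n₂; omega), hi] at h1
      linarith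
  refine ⟨P, ⟨k + 1, hPk⟩, ⟨n₃, heq⟩, fun e l he hH => ?_⟩
  have hdiff' : ∀ n ≥ l, imageHilbert 𝒜 π (n + 1) - imageHilbert 𝒜 π n =
      imageHilbert 𝒜 (φ ∘ₗ π) (n + 1) := by
    intro n hn
    have := hdiff (n + 1) (by
      rw [add_sub_cancel_right]
      exact hΓ0 n (hH 0 (Nat.zero_le e) n hn))
    rwa [add_sub_cancel_right] at this
  cases e with
  | zero =>
    -- Here `P = 0`. Multiplication by `x` makes the Hilbert function nondecreasing from `l` on, and
    -- it ends at `0`.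
    have hmono : ∀ n ≥ l, ∀ m ≥ n, imageHilbert 𝒜 π n ≤ imageHilbert 𝒜 π m := by
      intro n hn m hm
      induction m, hm using Int.leInduction with
      | base => exact le_rfl
      | succ m hm hi =>
        have := hdiff' m (hn.trans hm)
        have := imageHilbert_nonneg (𝒜 := 𝒜) (π := φ ∘ₗ π) (m + 1)
        linarith
    intro n hn
    have h1 := hmono n hn (max n n₃) (le_max_left _ _)
    rw [heq _ (le_max_right _ _), he.eq_zero] at h1
    rw [he.eq_zero]
    exact le_antisymm h1 (imageHilbert_nonneg n)
  | succ e =>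
    have he' : IsNumPoly e P'' := by
      have := he.sub_shift
      simpa only [hPdiff] using this
    -- Degree `n` of `N / x N` involves degree `n - 1` of `N`, so vanishing is inherited only from
    -- `l + 1` on; this is enough for differences starting at `l`.
    have hval := hP'' e (l + 1) he' fun i hi n hn =>
      cocycles_le_coboundaries_of_quotient hf φ hx hφx
        (by rintro n _ ⟨b, hb, rfl⟩; exact ⟨b, hb, rfl⟩)
        (by rintro n _ ⟨b, hb, rfl⟩; exact ⟨π b, ⟨b, hb, rfl⟩, rfl⟩)
        (fun n y hy h0 => hA.exists_smul_eq_of_mkQ_eq_zero hx hpr hy h0)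
        (eq_zero_of_smul_eq_zero_of_forall fun y hy => hΓf y (hxreg y hy))
        (hH i (by omega) n (by omega)) (hH (i + 1) (by omega) (n - 1) (by omega))
    have hconst : ∀ n ≥ l, ∀ m ≥ n, imageHilbert 𝒜 π m - P m = imageHilbert 𝒜 π n - P n := by
      intro n hn m hm
      induction m, hm using Int.leInduction with
      | base => rfl
      | succ m hm hi =>
        have h1 := hdiff' m (hn.trans hm)
        rw [hval (m + 1) (by omega)] at h1
        have h2 := hPdiff (m + 1)
        rw [add_sub_cancel_right] at h2
        linarith
    intro n hn
    have h1 := hconst n hn (max n n₃) (le_max_left _ _)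
    rw [heq _ (le_max_right _ _), sub_self] at h1
    linarith

end Graded

/-! ### The associated graded ring of a filtration -/

namespace MulFiltration

variable {R : Type*} [CommRing R] (F : MulFiltration R)

lemma antitone_ideal : Antitone F.ideal := antitone_int_of_succ_le F.anti

lemma coeff_single_mul_apply (m n : ℤ) (r : R) (p : R[T;T⁻¹]) :
    (AddMonoidAlgebra.single m r * p : R[T;T⁻¹]).coeff n = r * p.coeff (n - m) :=
  AddMonoidAlgebra.coeff_single_mul_eq_mul_coeff _ fun _ _ => by omega

/-- The inclusion `a ↦ a tⁿ` of `Iₙ` into the extended Rees algebra. -/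
def reesMonomial (n : ℤ) : F.ideal n →ₗ[R] F.extendedRees where
  toFun a := ⟨AddMonoidAlgebra.single n (a : R), fun m => by
    rw [AddMonoidAlgebra.coeff_single, Finsupp.single_apply]
    split_ifs with h
    · exact h ▸ a.2
    · exact zero_mem _⟩
  map_add' a b := Subtype.ext (AddMonoidAlgebra.single_add _ _ _)
  map_smul' r a := Subtype.ext (AddMonoidAlgebra.smul_single r n (a : R)).symm

lemma coe_reesMonomial (n : ℤ) (a : F.ideal n) :
    (F.reesMonomial n a : R[T;T⁻¹]) = AddMonoidAlgebra.single n (a : R) := rfl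

lemma coeff_reesMonomial (n m : ℤ) (a : F.ideal n) :
    (F.reesMonomial n a : R[T;T⁻¹]).coeff m = if n = m then (a : R) else 0 := by
  rw [coe_reesMonomial, AddMonoidAlgebra.coeff_single, Finsupp.single_apply]

lemma reesMonomial_mul {m n k : ℤ} (a : F.ideal m) (b : F.ideal n) (c : F.ideal k)
    (hk : k = m + n) (hc : (c : R) = a * b) :
    F.reesMonomial m a * F.reesMonomial n b = F.reesMonomial k c := by
  refine Subtype.ext ?_
  change (AddMonoidAlgebra.single m (a : R) * AddMonoidAlgebra.single n (b : R) : R[T;T⁻¹]) = _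
  rw [AddMonoidAlgebra.single_mul_single, coe_reesMonomial, hc, hk]

lemma tInv_eq : F.tInv = F.reesMonomial (-1)
    ⟨1, F.ideal_eq_top_of_nonpos (show (-1 : ℤ) ≤ 0 by omega) ▸ Submodule.mem_top⟩ := rfl

/-- The projection of the extended Rees algebra onto the component of degree `n`. -/
def reesProj (n : ℤ) : F.extendedRees →ₗ[R] F.extendedRees where
  toFun p := F.reesMonomial n ⟨(p : R[T;T⁻¹]).coeff n, p.2 n⟩
  map_add' p q := by
    rw [← map_add]
    rfl
  map_smul' r p := by
    rw [RingHom.id_apply, ← map_smul]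
    rfl

lemma reesProj_apply (n : ℤ) (p : F.extendedRees) :
    F.reesProj n p = F.reesMonomial n ⟨(p : R[T;T⁻¹]).coeff n, p.2 n⟩ := rfl

lemma reesProj_mul (n m : ℤ) (a : F.ideal m) (p : F.extendedRees) :
    F.reesProj n (F.reesMonomial m a * p) = F.reesMonomial m a * F.reesProj (n - m) p := by
  rw [reesProj_apply, reesProj_apply]
  refine (F.reesMonomial_mul _ _ _ (by ring) ?_).symm
  exact coeff_single_mul_apply _ _ _ _

lemma eq_sum_reesMonomial (p : F.extendedRees) :
    p = ∑ n ∈ (p : R[T;T⁻¹]).coeff.support, F.reesProj n p := by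
  refine Subtype.ext (LaurentPolynomial.ext fun m => ?_)
  rw [AddSubmonoidClass.coe_finsetSum, AddMonoidAlgebra.coeff_sum, Finsupp.finsetSum_apply]
  simp only [reesProj_apply, coeff_reesMonomial]
  rw [Finset.sum_ite_eq']
  split_ifs with h
  · rfl
  · exact Finsupp.notMem_support_iff.mp h

/-- The map `a ↦ a tⁿ` from `Iₙ` to the associated graded ring. -/
def toGraded (n : ℤ) : F.ideal n →ₗ[R] F.AssociatedGraded :=
  (Ideal.Quotient.mkₐ R (Ideal.span {F.tInv})).toLinearMap ∘ₗ F.reesMonomial n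

lemma toGraded_apply (n : ℤ) (a : F.ideal n) :
    F.toGraded n a = Ideal.Quotient.mk (Ideal.span {F.tInv}) (F.reesMonomial n a) := rfl

lemma toGraded_mul {m n k : ℤ} (a : F.ideal m) (b : F.ideal n) (c : F.ideal k)
    (hk : k = m + n) (hc : (c : R) = a * b) :
    F.toGraded m a * F.toGraded n b = F.toGraded k c := by
  simp only [toGraded_apply]
  rw [← map_mul, F.reesMonomial_mul a b c hk hc]

/-- Multiplication by `t⁻¹` shifts coefficients: the coefficient of `t⁻¹ q` in degree `n` is that of
`q` in degree `n + 1`, an element of `Iₙ₊₁`. -/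
lemma toGraded_eq_zero_iff {n : ℤ} (a : F.ideal n) :
    F.toGraded n a = 0 ↔ (a : R) ∈ F.ideal (n + 1) := by
  rw [toGraded_apply, Ideal.Quotient.eq_zero_iff_mem, Ideal.mem_span_singleton']
  constructor
  · rintro ⟨q, hq⟩
    have h := congrArg (fun p : F.extendedRees => (p : R[T;T⁻¹]).coeff n) hq
    simp only [coeff_reesMonomial, if_true] at h
    rw [mul_comm] at h
    have h1 : ((F.tInv * q : F.extendedRees) : R[T;T⁻¹]).coeff n =
        1 * (q : R[T;T⁻¹]).coeff (n - -1) := coeff_single_mul_apply _ _ _ _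
    rw [h1, one_mul, sub_neg_eq_add] at h
    exact h ▸ q.2 (n + 1)
  · intro h
    refine ⟨F.reesMonomial (n + 1) ⟨a, h⟩, ?_⟩
    rw [tInv_eq]
    exact F.reesMonomial_mul _ _ _ (by ring) (by simp)

lemma mem_gradedPiece_iff {n : ℤ} {y : F.AssociatedGraded} :
    y ∈ F.gradedPiece n ↔ ∃ a, F.toGraded n a = y := by
  constructor
  · rintro ⟨p, hp, rfl⟩
    refine ⟨⟨(p : R[T;T⁻¹]).coeff n, p.2 n⟩, ?_⟩
    refine congrArg (Ideal.Quotient.mk (Ideal.span {F.tInv})) (Subtype.ext ?_)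
    refine LaurentPolynomial.ext fun m => ?_
    rw [coeff_reesMonomial]
    split_ifs with h
    · rw [h]
    · exact (hp m (Ne.symm h)).symm
  · rintro ⟨a, rfl⟩
    refine ⟨F.reesMonomial n a, fun m hm => ?_, rfl⟩
    rw [coeff_reesMonomial, if_neg (Ne.symm hm)]

lemma toGraded_mem (n : ℤ) (a : F.ideal n) : F.toGraded n a ∈ F.gradedPiece n :=
  F.mem_gradedPiece_iff.mpr ⟨a, rfl⟩

lemma algebraMap_eq_toGraded (r : R) : algebraMap R F.AssociatedGraded r =
    F.toGraded 0 ⟨r, F.zero ▸ Submodule.mem_top⟩ := rfl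

/-- The projection of the associated graded ring onto the component of degree `n`. -/
def gradedProj (n : ℤ) : F.AssociatedGraded →ₗ[R] F.AssociatedGraded :=
  let e := Submodule.Quotient.restrictScalarsEquiv R (Ideal.span {F.tInv})
  e.toLinearMap ∘ₗ Submodule.mapQ _ _ (F.reesProj n) (by
    -- `t⁻¹` is homogeneous, so the projections preserve the ideal it generates.
    intro p hp
    obtain ⟨q, rfl⟩ := Ideal.mem_span_singleton'.mp hp
    rw [Submodule.mem_comap, mul_comm, tInv_eq, reesProj_mul]
    exact Ideal.mul_mem_right _ _ (Ideal.mem_span_singleton_self _)) ∘ₗ e.symm.toLinearMap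

lemma gradedProj_mk (n : ℤ) (p : F.extendedRees) :
    F.gradedProj n (Ideal.Quotient.mk _ p) = Ideal.Quotient.mk _ (F.reesProj n p) := rfl

lemma gradedProj_mem (n : ℤ) (a : F.AssociatedGraded) : F.gradedProj n a ∈ F.gradedPiece n := by
  obtain ⟨p, rfl⟩ := Ideal.Quotient.mk_surjective a
  exact F.toGraded_mem n _

lemma gradedProj_self {n : ℤ} {a : F.AssociatedGraded} (ha : a ∈ F.gradedPiece n) :
    F.gradedProj n a = a := by
  obtain ⟨a, rfl⟩ := F.mem_gradedPiece_iff.mp ha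
  rw [toGraded_apply, gradedProj_mk, reesProj_apply]
  have h : (⟨(F.reesMonomial n a : R[T;T⁻¹]).coeff n, (F.reesMonomial n a).2 n⟩ : F.ideal n) = a :=
    Subtype.ext ((F.coeff_reesMonomial n n a).trans (if_pos rfl))
  rw [h]

lemma gradedProj_mul (n : ℤ) {m : ℤ} {x : F.AssociatedGraded} (hx : x ∈ F.gradedPiece m)
    (a : F.AssociatedGraded) : F.gradedProj n (x * a) = x * F.gradedProj (n - m) a := by
  obtain ⟨x, rfl⟩ := F.mem_gradedPiece_iff.mp hx
  obtain ⟨p, rfl⟩ := Ideal.Quotient.mk_surjective a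
  rw [toGraded_apply, gradedProj_mk, ← map_mul, gradedProj_mk, reesProj_mul, map_mul]

lemma mem_of_forall_gradedPiece_le (S : Submodule R F.AssociatedGraded)
    (h : ∀ n, F.gradedPiece n ≤ S) (a : F.AssociatedGraded) : a ∈ S := by
  obtain ⟨p, rfl⟩ := Ideal.Quotient.mk_surjective a
  rw [F.eq_sum_reesMonomial p, map_sum]
  exact sum_mem fun n _ => h n (F.toGraded_mem n _)

/-- The filtration of an admissible filtration is eventually `I`-stable. -/
lemma IsAdmissible.exists_stable {F : MulFiltration R} [IsNoetherianRing R] {I : Ideal R}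
    (hF : F.IsAdmissible I) : ∃ n₀ : ℕ, ∀ n : ℤ, n₀ ≤ n → F.ideal (n + 1) = I * F.ideal n := by
  have hI1 : I ≤ F.ideal 1 := by simpa using hF.pow_le 1
  let F₁ : I.Filtration R :=
    { N := fun i => F.ideal i
      mono := fun i => by exact_mod_cast F.anti i
      smul_le := fun i => by
        rw [smul_eq_mul]
        refine (Ideal.mul_mono_left hI1).trans ((F.mul_le _ _).trans ?_)
        rw [add_comm]
        push_cast
        exact le_rfl }
  obtain ⟨k, hk⟩ := hF.le_pow
  -- With truncated subtraction, `I ^ (i - k)` is `I`-stable from index `k` on; over a Noetherian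
  -- ring a filtration contained in a stable one is stable.
  let F₂ : I.Filtration R :=
    { N := fun i => I ^ (i - k)
      mono := fun i => Ideal.pow_le_pow_right (by omega)
      smul_le := fun i => by
        rw [smul_eq_mul, ← pow_succ']
        exact Ideal.pow_le_pow_right (by omega) }
  have h₂ : F₂.Stable := ⟨k, fun n hn => by
    change I • I ^ (n - k) = I ^ (n + 1 - k)
    rw [smul_eq_mul, ← pow_succ', Nat.sub_add_comm hn]⟩
  have hle : F₁ ≤ F₂ := fun i => by
    refine (hk i).trans (Ideal.pow_le_pow_right ?_)
    omega
  obtain ⟨n₀, h⟩ := h₂.of_le hle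
  refine ⟨n₀, fun n hn => ?_⟩
  lift n to ℕ using (by omega)
  have := h n (by exact_mod_cast hn)
  rw [smul_eq_mul] at this
  exact_mod_cast this.symm

/-! ### Finite generation and prime avoidance in the associated graded ring -/

section Model

variable {A : Type*} [CommRing A] [Algebra R A]

/-- `A`, with the pieces `𝒜`, is an associated graded ring of the filtration: `𝒜 n` is the image of
a map `τ n` that induces an isomorphism from `Iₙ / Iₙ₊₁`, compatibly with products. -/
structure IsAssociatedGraded (𝒜 : ℤ → Submodule R A) (τ : ∀ n, F.ideal n →ₗ[R] A) : Prop where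
  mul : ∀ {m n k : ℤ} (a : F.ideal m) (b : F.ideal n) (c : F.ideal k), k = m + n →
    (c : R) = a * b → τ m a * τ n b = τ k c
  eq_zero_iff : ∀ {n : ℤ} (a : F.ideal n), τ n a = 0 ↔ (a : R) ∈ F.ideal (n + 1)
  algebraMap_eq : ∀ (r : R) (h : r ∈ F.ideal 0), algebraMap R A r = τ 0 ⟨r, h⟩
  mem_iff : ∀ {n : ℤ} {y : A}, y ∈ 𝒜 n ↔ ∃ a, τ n a = y
  mem_of_le : ∀ S : Submodule R A, (∀ n, 𝒜 n ≤ S) → ∀ a, a ∈ S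

lemma isAssociatedGraded :
    F.IsAssociatedGraded (A := F.AssociatedGraded) F.gradedPiece F.toGraded where
  mul := F.toGraded_mul
  eq_zero_iff := F.toGraded_eq_zero_iff
  algebraMap_eq r _ := F.algebraMap_eq_toGraded r
  mem_iff := F.mem_gradedPiece_iff
  mem_of_le := F.mem_of_forall_gradedPiece_le

namespace IsAssociatedGraded

variable {F} {𝒜 : ℤ → Submodule R A} {τ : ∀ n, F.ideal n →ₗ[R] A}
  (hG : F.IsAssociatedGraded 𝒜 τ)

include hG

lemma mem (n : ℤ) (a : F.ideal n) : τ n a ∈ 𝒜 n := hG.mem_iff.mpr ⟨a, rfl⟩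

lemma range_eq (n : ℤ) : LinearMap.range (τ n) = 𝒜 n := by
  ext y
  rw [hG.mem_iff, LinearMap.mem_range]

lemma mul_mem {m n : ℤ} {a b : A} (ha : a ∈ 𝒜 m) (hb : b ∈ 𝒜 n) : a * b ∈ 𝒜 (m + n) := by
  obtain ⟨a, rfl⟩ := hG.mem_iff.mp ha
  obtain ⟨b, rfl⟩ := hG.mem_iff.mp hb
  rw [hG.mul a b ⟨a * b, F.mul_le m n (Ideal.mul_mem_mul a.2 b.2)⟩ rfl rfl]
  exact hG.mem _ _

lemma one_mem : (1 : A) ∈ 𝒜 0 := by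
  rw [← map_one (algebraMap R A), hG.algebraMap_eq 1 (F.zero ▸ Submodule.mem_top)]
  exact hG.mem _ _

lemma pow_mem {n : ℤ} {a : A} (ha : a ∈ 𝒜 n) (s : ℕ) : a ^ s ∈ 𝒜 (s * n) := by
  induction s with
  | zero => simpa using hG.one_mem
  | succ s ih =>
    rw [pow_succ]
    have := hG.mul_mem ih ha
    rwa [show (s : ℤ) * n + n = ((s + 1 : ℕ) : ℤ) * n by push_cast; ring] at this

lemma eq_zero_of_neg {n : ℤ} (hn : n < 0) {a : A} (ha : a ∈ 𝒜 n) : a = 0 := by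
  obtain ⟨a, rfl⟩ := hG.mem_iff.mp ha
  rw [hG.eq_zero_iff, F.ideal_eq_top_of_nonpos (by omega)]
  trivial

/-- `ℓ(R / Iₙ₊₁) = ℓ([G]ₙ) + ℓ(R / Iₙ)`. -/
lemma length_quotient_succ (n : ℤ) : Module.length R (R ⧸ F.ideal (n + 1)) =
    Module.length R (𝒜 n) + Module.length R (R ⧸ F.ideal n) := by
  set g : F.ideal n →ₗ[R] R ⧸ F.ideal (n + 1) :=
    (F.ideal (n + 1)).mkQ ∘ₗ (F.ideal n).subtype with hg
  have hker : LinearMap.ker (τ n) = LinearMap.ker g := by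
    ext a
    rw [LinearMap.mem_ker, hG.eq_zero_iff, LinearMap.mem_ker, hg, LinearMap.comp_apply,
      Submodule.mkQ_apply, Submodule.Quotient.mk_eq_zero]
    rfl
  -- Both sides are `Iₙ` modulo `Iₙ₊₁`.
  have e : 𝒜 n ≃ₗ[R] LinearMap.range g :=
    (LinearEquiv.ofEq _ _ (hG.range_eq n)).symm ≪≫ₗ
      (τ n).quotKerEquivRange.symm ≪≫ₗ Submodule.quotEquivOfEq _ _ hker ≪≫ₗ
      g.quotKerEquivRange
  rw [e.length_eq]
  refine Module.length_eq_add_of_exact (LinearMap.range g).subtype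
    (Submodule.factor (F.anti n)) (Submodule.subtype_injective _)
    (Submodule.factor_surjective _) fun y => ?_
  obtain ⟨a, rfl⟩ := Submodule.mkQ_surjective _ y
  have hfac : Submodule.factor (F.anti n) ((F.ideal (n + 1)).mkQ a) = 0 ↔ a ∈ F.ideal n :=
    Submodule.Quotient.mk_eq_zero _
  rw [hfac]
  constructor
  · intro ha
    exact ⟨⟨_, ⟨⟨a, ha⟩, rfl⟩⟩, rfl⟩
  · rintro ⟨⟨_, ⟨b, rfl⟩⟩, hb⟩
    have h1 : a - (b : R) ∈ F.ideal (n + 1) := by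
      rw [← Submodule.Quotient.eq]
      exact hb.symm
    have := add_mem (F.anti n h1) b.2
    rwa [sub_add_cancel] at this

variable {I : Ideal R} {n₀ : ℕ} (hI1 : I ≤ F.ideal 1)
  (hst : ∀ n : ℤ, n₀ ≤ n → F.ideal (n + 1) = I * F.ideal n)

include hst in
/-- Elements of large degree of the associated graded ring are sums of products of linear forms
coming from `I` with elements of one degree less. -/
lemma induction_of_stable {n : ℤ} (hn : n₀ ≤ n) {S : AddSubmonoid A}
    (h : ∀ (i : R) (hi : i ∈ I), ∀ y ∈ 𝒜 n, τ 1 ⟨i, hI1 hi⟩ * y ∈ S)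
    {z : A} (hz : z ∈ 𝒜 (n + 1)) : z ∈ S := by
  obtain ⟨⟨a, ha⟩, rfl⟩ := hG.mem_iff.mp hz
  have ha' := ha
  rw [hst n hn] at ha'
  have key : ∃ ha : a ∈ F.ideal (n + 1), τ (n + 1) ⟨a, ha⟩ ∈ S := by
    refine Submodule.mul_induction_on ha' (fun i hi b hb => ?_) fun a b ⟨ha, ha'⟩ ⟨hb, hb'⟩ => ?_
    · have hib : i * b ∈ F.ideal (n + 1) := by
        rw [hst n hn]
        exact Ideal.mul_mem_mul hi hb
      refine ⟨hib, ?_⟩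
      rw [← hG.mul ⟨i, hI1 hi⟩ ⟨b, hb⟩ ⟨i * b, hib⟩ (by ring) rfl]
      exact h i hi _ (hG.mem _ _)
    · refine ⟨add_mem ha hb, ?_⟩
      have := S.add_mem ha' hb'
      rwa [← map_add] at this
  exact key.2

include hI1 hst

/-- By stability the components of degree `0` to `n₀ + 1` generate the algebra, and each is a finite
`R`-module. -/
lemma isNoetherianRing [IsNoetherianRing R] : IsNoetherianRing A := by
  classical
  have hfg : ∀ n : ℤ, ∃ s : Finset A, Submodule.span R (s : Set A) = 𝒜 n := by
    intro n
    rw [← hG.range_eq, LinearMap.range_eq_map]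
    exact (Module.Finite.fg_top.map (τ n))
  choose s hs using hfg
  set B := Algebra.adjoin R
    (((Finset.Icc (0 : ℤ) (n₀ + 1)).biUnion s : Finset _) : Set A) with hB
  have hsmall : ∀ n : ℤ, 0 ≤ n → n ≤ n₀ + 1 → ∀ a ∈ 𝒜 n, a ∈ B := by
    intro n h0 hn a ha
    rw [← hs] at ha
    refine (Submodule.span_le (p := Subalgebra.toSubmodule B)).mpr (fun b hb => ?_) ha
    exact Algebra.subset_adjoin
      (Finset.mem_coe.mpr (Finset.mem_biUnion.mpr ⟨n, Finset.mem_Icc.mpr ⟨h0, hn⟩, hb⟩))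
  have hlarge : ∀ n : ℤ, (n₀ : ℤ) + 1 ≤ n → ∀ a ∈ 𝒜 n, a ∈ B := by
    intro n hn
    induction n, hn using Int.leInduction with
    | base => exact hsmall _ (by omega) le_rfl
    | succ n hn ih =>
      intro a ha
      exact hG.induction_of_stable hI1 hst (by omega)
        (S := (Subalgebra.toSubmodule B).toAddSubmonoid)
        (fun i hi y hy => B.mul_mem (hsmall 1 (by omega) (by omega) _ (hG.mem _ _)) (ih y hy)) ha
  have htop : B = ⊤ := by
    rw [eq_top_iff]
    rintro a -
    refine hG.mem_of_le (Subalgebra.toSubmodule B) (fun n b hb => ?_) a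
    rw [Subalgebra.mem_toSubmodule]
    rcases lt_or_ge n 0 with h | h
    · rw [hG.eq_zero_of_neg h hb]
      exact zero_mem _
    · rcases le_total n (n₀ + 1) with h' | h'
      · exact hsmall n h h' b hb
      · exact hlarge n h' b hb
  have : Algebra.FiniteType R A := ⟨⟨_, htop⟩⟩
  exact Algebra.FiniteType.isNoetherianRing R A

/-- Each degree beyond `n₀` splits off a linear form, which lies in `M`. -/
lemma le_pow {M : Ideal A} (hM : ∀ n : ℤ, 0 < n → ∀ a ∈ 𝒜 n, a ∈ M) (s : ℕ) :
    ∀ n ≥ (n₀ : ℤ) + s, ∀ a ∈ 𝒜 n, a ∈ M ^ s := by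
  induction s with
  | zero => simp
  | succ s ih =>
    intro n hn a ha
    obtain ⟨n, rfl⟩ : ∃ m, n = m + 1 := ⟨n - 1, by ring⟩
    refine hG.induction_of_stable hI1 hst (by push_cast at hn; omega)
      (S := (M ^ (s + 1)).toAddSubmonoid) (fun i hi y hy => ?_) ha
    have := Ideal.mul_mem_mul (hM 1 one_pos _ (hG.mem 1 ⟨i, hI1 hi⟩))
      (ih n (by push_cast at hn; omega) y hy)
    rwa [← pow_succ'] at this

variable [IsLocalRing R] (hI : I.radical = IsLocalRing.maximalIdeal R)
include hI

omit hst in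
-- Some power of `r` lies in `I ⊆ I₁`, and `I₁` dies in `G₀ = R / I₁`.
lemma algebraMap_pow_eq_zero {r : R} (hr : r ∈ IsLocalRing.maximalIdeal R) :
    ∃ s : ℕ, algebraMap R A r ^ s = 0 := by
  rw [← hI] at hr
  obtain ⟨s, hs⟩ := hr
  refine ⟨s, ?_⟩
  rw [← map_pow, hG.algebraMap_eq _ (F.zero ▸ Submodule.mem_top), hG.eq_zero_iff]
  exact hI1 hs

/-- A prime that contains the linear forms coming from `I` contains the homogeneous maximal
ideal. -/
lemma span_le_of_isPrime {P : Ideal A} [P.IsPrime]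
    (hP : ∀ (i : R) (hi : i ∈ I), τ 1 ⟨i, hI1 hi⟩ ∈ P) :
    Ideal.span (algebraMap R A '' IsLocalRing.maximalIdeal R ∪
      ⋃ n : ℤ, ⋃ _ : 0 < n, (𝒜 n : Set A)) ≤ P := by
  rw [Ideal.span_le]
  rintro y (⟨r, hr, rfl⟩ | hy)
  · obtain ⟨s, hs⟩ := hG.algebraMap_pow_eq_zero hI1 hI hr
    exact Ideal.IsPrime.mem_of_pow_mem inferInstance s (hs ▸ P.zero_mem)
  · obtain ⟨n, hn, hy⟩ := Set.mem_iUnion₂.mp hy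
    -- This power has degree above `n₀`, so it is a combination of linear forms coming from `I`.
    have h1 := hG.pow_mem hy (n₀ + 1)
    refine Ideal.IsPrime.mem_of_pow_mem inferInstance (n₀ + 1) ?_
    rw [show ((n₀ + 1 : ℕ) : ℤ) * n = (((n₀ + 1 : ℕ) : ℤ) * n - 1) + 1 by ring] at h1
    exact hG.induction_of_stable hI1 hst (by push_cast; nlinarith)
      (S := P.toAddSubmonoid) (fun i hi y _ => P.mul_mem_right y (hP i hi)) h1

/-- Prime avoidance by linear forms, over an infinite residue field. -/
lemma exists_avoiding [Infinite (IsLocalRing.ResidueField R)]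
    (T : Set (Ideal A)) (hT : T.Finite)
    (hTP : ∀ P ∈ T, P.IsPrime ∧ ¬ Ideal.span (algebraMap R A '' IsLocalRing.maximalIdeal R ∪
      ⋃ n : ℤ, ⋃ _ : 0 < n, (𝒜 n : Set A)) ≤ P) :
    ∃ x ∈ 𝒜 1, ∀ P ∈ T, x ∉ P := by
  set φ : I →ₗ[R] A := τ 1 ∘ₗ Submodule.inclusion hI1 with hφ
  by_contra! hcon
  have hcover : ⋃ P ∈ hT.toFinset,
      (((P.restrictScalars R).comap φ : Submodule R I) : Set I) = Set.univ := by
    refine Set.eq_univ_of_forall fun i => ?_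
    obtain ⟨P, hPT, hP⟩ := hcon (φ i) (hG.mem _ _)
    exact Set.mem_iUnion₂.mpr ⟨P, hT.mem_toFinset.mpr hPT, hP⟩
  -- If finitely many submodules cover a module, one of them has finite index (B. H. Neumann).
  obtain ⟨P, hPT, hfin⟩ := Submodule.exists_finiteIndex_of_cover hcover
  obtain ⟨hprime, hM⟩ := hTP P (hT.mem_toFinset.mp hPT)
  obtain ⟨i, hi, hiP⟩ : ∃ (i : R) (hi : i ∈ I), τ 1 ⟨i, hI1 hi⟩ ∉ P := by
    by_contra! h
    exact hM (hG.span_le_of_isPrime hI1 hst hI h)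
  set V := (P.restrictScalars R).comap φ with hV
  have hfinite : Finite (I ⧸ V) :=
    (AddSubgroup.finiteIndex_iff_finite_quotient (H := V.toAddSubgroup)).mp hfin
  -- Multiples of `i ∉ V` embed the residue field in the finite quotient `I ⧸ V`, a contradiction.
  let g : R →ₗ[R] I ⧸ V := LinearMap.toSpanSingleton R _ (V.mkQ ⟨i, hi⟩)
  have hgmem : ∀ r, r ∈ LinearMap.ker g ↔ r • τ 1 ⟨i, hI1 hi⟩ ∈ P := by
    intro r
    rw [LinearMap.mem_ker, LinearMap.toSpanSingleton_apply, ← map_smul, Submodule.mkQ_apply,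
      Submodule.Quotient.mk_eq_zero, hV, Submodule.mem_comap, map_smul]
    rfl
  have hg : LinearMap.ker g = IsLocalRing.maximalIdeal R := by
    refine le_antisymm (IsLocalRing.le_maximalIdeal fun h => hiP ?_) fun r hr => ?_
    · have := (hgmem 1).mp (h ▸ Submodule.mem_top)
      rwa [one_smul] at this
    · rw [hgmem, Algebra.smul_def]
      obtain ⟨s, hs⟩ := hG.algebraMap_pow_eq_zero hI1 hI hr
      exact P.mul_mem_right _ (hprime.mem_of_pow_mem s (hs ▸ P.zero_mem))
  have h1 : Finite (R ⧸ LinearMap.ker g) := Finite.of_equiv _ g.quotKerEquivRange.symm.toEquiv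
  rw [hg] at h1
  exact not_finite_iff_infinite.mpr ‹Infinite (IsLocalRing.ResidueField R)› h1

end IsAssociatedGraded

end Model

end MulFiltration

/-! ### Growth of colengths -/

section Growth

variable {R : Type*} [CommRing R]

/-- Multiplication by `a` gives an exact sequence `R/(J,b) → R/(J,ab) → R/(J,a) → 0`. -/
lemma length_quotient_sup_mul_le (J : Ideal R) (a b : R) :
    Module.length R (R ⧸ J ⊔ Ideal.span {a * b}) ≤
      Module.length R (R ⧸ J ⊔ Ideal.span {b}) + Module.length R (R ⧸ J ⊔ Ideal.span {a}) := by
  have hle : J ⊔ Ideal.span {a * b} ≤ J ⊔ Ideal.span {a} :=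
    sup_le_sup_left (Ideal.span_singleton_le_span_singleton.mpr (dvd_mul_right a b)) J
  let f : (R ⧸ J ⊔ Ideal.span {b}) →ₗ[R] (R ⧸ J ⊔ Ideal.span {a * b}) :=
    Submodule.mapQ _ _ (LinearMap.mulLeft R a) (by
      refine sup_le (fun x hx => Ideal.mem_sup_left (J.mul_mem_left a hx)) ?_
      refine Ideal.span_le.mpr (Set.singleton_subset_iff.mpr ?_)
      exact Ideal.mem_sup_right (Ideal.mem_span_singleton_self _))
  let g : (R ⧸ J ⊔ Ideal.span {a * b}) →ₗ[R] (R ⧸ J ⊔ Ideal.span {a}) := Submodule.factor hle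
  have hg : Function.Surjective g := Submodule.factor_surjective hle
  have hker : LinearMap.ker g ≤ LinearMap.range f := by
    intro z hz
    obtain ⟨x, rfl⟩ := Submodule.mkQ_surjective _ z
    have hx : x ∈ J ⊔ Ideal.span {a} := (Submodule.Quotient.mk_eq_zero _).mp hz
    obtain ⟨j, hj, y, hy, rfl⟩ := Submodule.mem_sup.mp hx
    obtain ⟨c, rfl⟩ := Ideal.mem_span_singleton'.mp hy
    refine ⟨Submodule.Quotient.mk c, ?_⟩
    change Submodule.Quotient.mk (a * c) = Submodule.Quotient.mk (j + c * a)
    rw [Submodule.Quotient.eq]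
    refine Ideal.mem_sup_left ?_
    rw [show a * c - (j + c * a) = -j by ring]
    exact neg_mem hj
  rw [Module.length_eq_add_of_exact (LinearMap.ker g).subtype g (Submodule.subtype_injective _) hg
    (LinearMap.exact_subtype_ker_map g)]
  gcongr
  exact (Module.length_le_of_injective (Submodule.inclusion hker)
    (Submodule.inclusion_injective hker)).trans
    (Module.length_le_of_surjective f.rangeRestrict f.surjective_rangeRestrict)

lemma length_quotient_sup_pow_le (J : Ideal R) (a : R) (n : ℕ) :
    Module.length R (R ⧸ J ⊔ Ideal.span {a ^ n}) ≤
      n * Module.length R (R ⧸ J ⊔ Ideal.span {a}) := by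
  induction n with
  | zero =>
    have : Subsingleton (R ⧸ J ⊔ Ideal.span {a ^ 0}) := by
      rw [Submodule.Quotient.subsingleton_iff, pow_zero, Ideal.span_singleton_one, sup_top_eq]
    simp
  | succ n ih =>
    rw [pow_succ]
    refine (length_quotient_sup_mul_le J (a ^ n) a).trans ?_
    push_cast
    rw [add_mul, one_mul, add_comm]
    gcongr

/-- The generators are raised to the power `n` one at a time, the others being absorbed in `J`; each
costs a factor `n`. -/
lemma length_quotient_sup_span_image_pow_le (s : Finset R) (J : Ideal R) (n : ℕ) :
    Module.length R (R ⧸ J ⊔ Ideal.span ((· ^ n) '' (s : Set R))) ≤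
      (n : ℕ∞) ^ s.card * Module.length R (R ⧸ J ⊔ Ideal.span (s : Set R)) := by
  classical
  induction s using Finset.induction_on generalizing J with
  | empty => rw [Finset.coe_empty, Set.image_empty, Finset.card_empty, pow_zero, one_mul]
  | insert a s ha ih =>
    rw [Finset.coe_insert, Set.image_insert_eq, Ideal.span_insert, Ideal.span_insert, ← sup_assoc,
      Finset.card_insert_of_notMem ha, pow_succ, mul_assoc, sup_comm (Ideal.span {a}), ← sup_assoc]
    refine (ih _).trans ?_
    gcongr
    rw [sup_right_comm]
    exact length_quotient_sup_pow_le _ a n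

lemma length_quotient_le_of_le {J J' : Ideal R} (h : J ≤ J') :
    Module.length R (R ⧸ J') ≤ Module.length R (R ⧸ J) :=
  Module.length_le_of_surjective (Submodule.factor h) (Submodule.factor_surjective h)

variable [IsLocalRing R] [IsNoetherianRing R]

/-- Powers of a primary ideal have colength bounded by a polynomial of degree `dim R`. -/
lemma exists_length_quotient_pow_le {d : ℕ} (hd : ringKrullDim R = d) {I : Ideal R}
    (hI : I.radical = IsLocalRing.maximalIdeal R) :
    ∃ C : ℕ, ∀ n : ℕ, Module.length R (R ⧸ I ^ n) ≤ (C * n ^ d : ℕ) := by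
  -- `s` is a system of parameters: `d` elements over which the maximal ideal is a minimal prime.
  obtain ⟨s, hs, hcard⟩ :=
    (IsLocalRing.maximalIdeal R).exists_finset_card_eq_height_of_isNoetherianRing
  have hscard : s.card = d := by
    have h := IsLocalRing.maximalIdeal_height_eq_ringKrullDim (R := R)
    rw [hd, ← hcard] at h
    exact_mod_cast h
  have hart := IsLocalRing.quotient_artinian_of_mem_minimalPrimes_of_isLocalRing _ hs
  have : IsArtinian R (R ⧸ Ideal.span (s : Set R)) :=
    isArtinian_of_surjective_algebraMap (R := R ⧸ Ideal.span (s : Set R))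
      Ideal.Quotient.mk_surjective
  have hfin : Module.length R (R ⧸ Ideal.span (s : Set R)) ≠ ⊤ := by
    rw [Module.length_ne_top_iff, isFiniteLength_iff_isNoetherian_isArtinian]
    exact ⟨inferInstance, inferInstance⟩
  -- Since `𝔪ᶜ ⊆ I`, the powers of the parameters with exponent `c * n` lie in `Iⁿ`.
  obtain ⟨c, hc⟩ := I.exists_radical_pow_le_of_fg (IsNoetherian.noetherian _)
  refine ⟨c ^ d * (Module.length R (R ⧸ Ideal.span (s : Set R))).toNat, fun n => ?_⟩
  have hle : Ideal.span ((· ^ (c * n)) '' (s : Set R)) ≤ I ^ n := by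
    rw [Ideal.span_le]
    rintro _ ⟨y, hy, rfl⟩
    have hym : y ∈ I.radical := hI ▸ hs.1.2 (Ideal.subset_span hy)
    have := Ideal.pow_mem_pow (hc (Ideal.pow_mem_pow hym c)) n
    rwa [← pow_mul] at this
  have h := length_quotient_sup_span_image_pow_le s ⊥ (c * n)
  rw [bot_sup_eq, bot_sup_eq, hscard] at h
  refine ((length_quotient_le_of_le hle).trans h).trans (le_of_eq ?_)
  conv_lhs => rw [← ENat.natCast_toNat hfin]
  push_cast
  ring

end Growth

/-! ### The Hilbert–Samuel function of an admissible filtration -/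

namespace MulFiltration

variable {R : Type*} [CommRing R] {F : MulFiltration R} {I : Ideal R}

lemma IsAdmissible.exists_length_le [IsLocalRing R] [IsNoetherianRing R] (hF : F.IsAdmissible I)
    {d : ℕ} (hd : ringKrullDim R = d) (hI : I.radical = IsLocalRing.maximalIdeal R) :
    ∃ C : ℕ, ∀ n : ℕ, Module.length R (R ⧸ F.ideal n) ≤ (C * n ^ d : ℕ) := by
  obtain ⟨C, hC⟩ := exists_length_quotient_pow_le hd hI
  exact ⟨C, fun n => (length_quotient_le_of_le (by simpa using hF.pow_le n)).trans (hC n)⟩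

lemma IsAdmissible.length_ne_top [IsLocalRing R] [IsNoetherianRing R] (hF : F.IsAdmissible I)
    {d : ℕ} (hd : ringKrullDim R = d) (hI : I.radical = IsLocalRing.maximalIdeal R) (n : ℤ) :
    Module.length R (R ⧸ F.ideal n) ≠ ⊤ := by
  obtain ⟨C, hC⟩ := hF.exists_length_le hd hI
  refine ne_top_of_le_ne_top (ENat.natCast_ne_top _)
    ((length_quotient_le_of_le (F.antitone_ideal n.self_le_toNat)).trans (hC n.toNat))

universe u

open GradedCech in
/-- If the cohomology of the associated graded ring vanishes in degrees `≥ l`, then the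
Hilbert-Samuel function agrees with a polynomial in degrees `≥ l`. -/
theorem IsAssociatedGraded.exists_isNumPoly [IsLocalRing R] [IsNoetherianRing R]
    [Infinite (IsLocalRing.ResidueField R)] {A : Type u} [CommRing A] [Algebra R A]
    {𝒜 : ℤ → Submodule R A} {τ : ∀ n, F.ideal n →ₗ[R] A} (hG : F.IsAssociatedGraded 𝒜 τ)
    {pr : ℤ → A →ₗ[R] A} (hpr_mem : ∀ n a, pr n a ∈ 𝒜 n) (hpr_self : ∀ n, ∀ a ∈ 𝒜 n, pr n a = a)
    (hpr_mul : ∀ n, ∀ x ∈ 𝒜 1, ∀ a, pr n (x * a) = x * pr (n - 1) a)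
    (hF : F.IsAdmissible I) {d : ℕ} (hd : ringKrullDim R = d)
    (hI : I.radical = IsLocalRing.maximalIdeal R)
    {r : ℕ} {f : Fin r → A} (hf : ∀ j, ∃ a, f j ∈ 𝒜 a)
    (hfM : ∀ j, f j ∈ (Ideal.span (algebraMap R A '' IsLocalRing.maximalIdeal R ∪
      ⋃ n : ℤ, ⋃ _ : 0 < n, (𝒜 n : Set A))).radical) {l : ℤ}
    (hcoh : ∀ i ≤ d, ∀ n ≥ l, cocycles f 𝒜 𝒜 i n ≤ coboundaries f 𝒜 𝒜 i n) :
    ∃ Q, IsNumPoly (d + 1) Q ∧ ∀ n ≥ l, colength (F.ideal n) = Q n := by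
  obtain ⟨n₀, hst⟩ := hF.exists_stable
  have hI1 : I ≤ F.ideal 1 := by simpa using hF.pow_le 1
  have hfin := hF.length_ne_top hd hI
  have hA : IsGradedWithLinearForms 𝒜 pr (Ideal.span (algebraMap R A ''
      IsLocalRing.maximalIdeal R ∪ ⋃ n : ℤ, ⋃ _ : 0 < n, (𝒜 n : Set A))) :=
    { one_mem := hG.one_mem
      mul_mem := hG.mul_mem
      pr_mem := hpr_mem
      pr_self := hpr_self
      pr_mul := hpr_mul
      length_ne_top := fun n => ne_top_of_le_ne_top (hfin (n + 1))
        ((hG.length_quotient_succ n).symm ▸ le_self_add)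
      exists_le_pow := fun s => ⟨_, hG.le_pow hI1 hst (fun n hn a ha =>
        Ideal.subset_span (Or.inr (Set.mem_iUnion₂.mpr ⟨n, hn, ha⟩))) s⟩
      exists_avoiding := hG.exists_avoiding hI1 hst hI }
  have := hG.isNoetherianRing hI1 hst
  have hid : imagePiece 𝒜 (LinearMap.id : A →ₗ[A] A) = 𝒜 := funext fun n => Submodule.map_id _
  obtain ⟨P, ⟨k, hk⟩, ⟨n₁, hn₁⟩, hP⟩ := hA.exists_hilbertPolynomial hf hfM _ A LinearMap.id
    Function.surjective_id rfl (by
      intro n a ha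
      rw [LinearMap.ker_id, Submodule.mem_bot] at ha
      rw [ha, map_zero]
      exact zero_mem _)
  have hdiff : ∀ n, colength (F.ideal (n + 1)) - colength (F.ideal n) =
      imageHilbert 𝒜 (LinearMap.id : A →ₗ[A] A) n := by
    intro n
    rw [imageHilbert, hid, colength, colength, hG.length_quotient_succ n,
      ENat.toNat_add (hA.length_ne_top n) (hfin n)]
    push_cast
    ring
  -- Antidifferences are backward, whereas colengths satisfy a forward equation; hence the shift by
  -- `-1`.
  obtain ⟨Q, hQk, hQ, hQn₁⟩ := (hk.comp_affine 1 (-1)).exists_antidifference n₁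
    (colength (F.ideal n₁))
  have hQ' : ∀ n, Q (n + 1) - Q n = P n := by
    intro n
    have := hQ (n + 1)
    rwa [add_sub_cancel_right, one_mul, add_neg_cancel_right] at this
  have heq : ∀ n ≥ n₁, colength (F.ideal n) = Q n := by
    intro n hn
    induction n, hn using Int.leInduction with
    | base => exact hQn₁.symm
    | succ n hn ih =>
      have h1 := hdiff n
      rw [hn₁ n hn, ih] at h1
      have h2 := hQ' n
      linarith
  -- Polynomial growth bounds the degree of `Q` by `d`. Then `P` has degree less than `d`, so
  -- vanishing of the cohomology for `i ≤ d` is enough.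
  have hQd : IsNumPoly (d + 1) Q := by
    obtain ⟨C, hC⟩ := hF.exists_length_le hd hI
    refine hQk.of_le_pow C (n₀ := n₁.toNat) fun n hn => ?_
    rw [← heq n (Int.toNat_le.mp hn), colength]
    refine ⟨Int.natCast_nonneg _, ?_⟩
    have := ENat.toNat_le_toNat (hC n) (ENat.natCast_ne_top _)
    rw [ENat.toNat_natCast] at this
    exact_mod_cast this
  have hPd : IsNumPoly d P := by
    have := hQd.sub_shift.comp_affine 1 1
    simpa only [one_mul, add_sub_cancel_right, hQ'] using this
  have hval := hP d l hPd (by rw [hid]; exact hcoh)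
  refine ⟨Q, hQd, ?_⟩
  have hconst : ∀ n ≥ l, ∀ m ≥ n,
      colength (F.ideal m) - Q m = colength (F.ideal n) - Q n := by
    intro n hn m hm
    induction m, hm using Int.leInduction with
    | base => rfl
    | succ m hm ih =>
      have h1 := hdiff m
      rw [hval m (hn.trans hm)] at h1
      have h2 := hQ' m
      linarith
  intro n hn
  have h1 := hconst n hn (max n n₁) (le_max_left _ _)
  rw [heq _ (le_max_right _ _), sub_self] at h1
  linarith

end MulFiltration

/-! ### From the `a`-invariants to the Hilbert coefficients -/

lemma GradedCech.cocycles_le_coboundaries_of_aInvariant_lt {R A : Type*} [CommRing R] [CommRing A]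
    [Algebra R A] {r : ℕ} {f : Fin r → A} {N : Type*} [AddCommGroup N] [Module A N] [Module R N]
    [IsScalarTower R A N] {𝒜 : ℤ → Submodule R A} {𝒩 : ℤ → Submodule R N} {i : ℕ} {l : ℤ}
    (h : aInvariant f 𝒜 𝒩 i < ((l : WithTop ℤ) : WithBot (WithTop ℤ))) {n : ℤ} (hn : l ≤ n) :
    cocycles f 𝒜 𝒩 i n ≤ coboundaries f 𝒜 𝒩 i n := by
  rw [← subsingleton_cohomology_iff, ← not_nontrivial_iff_subsingleton]
  intro hnt
  have h1 : ((n : WithTop ℤ) : WithBot (WithTop ℤ)) ≤ aInvariant f 𝒜 𝒩 i :=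
    le_iSup (fun n : {n : ℤ // Nontrivial (cohomology f 𝒜 𝒩 i n)} =>
      (((n : ℤ) : WithTop ℤ) : WithBot (WithTop ℤ))) ⟨n, hnt⟩
  have h2 := h1.trans_lt h
  rw [WithBot.coe_lt_coe, WithTop.coe_lt_coe] at h2
  omega

lemma colength_top {R : Type*} [CommRing R] : colength (⊤ : Ideal R) = 0 := by
  have : Subsingleton (R ⧸ (⊤ : Ideal R)) := Submodule.Quotient.subsingleton_iff.mpr rfl
  simp [colength]

/-- If all `aᵢ` of the associated graded ring are less than `l`, then the Hilbert-Samuel function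
agrees with a polynomial in degrees `≥ l`. -/
theorem MulFiltration.IsAdmissible.exists_isNumPoly_of_aInvariant_lt {R : Type*} [CommRing R]
    [IsLocalRing R] [IsNoetherianRing R] (hres : Infinite (IsLocalRing.ResidueField R))
    {d : ℕ} (hd : ringKrullDim R = d)
    {I : Ideal R} (hI : I.radical = IsLocalRing.maximalIdeal R)
    {F : MulFiltration R} (hF : F.IsAdmissible I) {r : ℕ} (f : Fin r → F.AssociatedGraded)
    (hf : IsHomogeneousSystem F.gradedPiece F.homogeneousMaximalIdeal f) {l : ℤ}
    (hl : ∀ i : ℕ, i ≤ d → GradedCech.aInvariant f F.gradedPiece F.gradedPiece i <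
      ((l : WithTop ℤ) : WithBot (WithTop ℤ))) :
    ∃ Q, IsNumPoly (d + 1) Q ∧ ∀ n ≥ l, colength (F.ideal n) = Q n := by
  have hfM : ∀ j, f j ∈ F.homogeneousMaximalIdeal.radical := fun j =>
    hf.radical_span ▸ Ideal.le_radical (Ideal.subset_span ⟨j, rfl⟩)
  have hcoh : ∀ i ≤ d, ∀ n ≥ l, GradedCech.cocycles f F.gradedPiece F.gradedPiece i n ≤
      GradedCech.coboundaries f F.gradedPiece F.gradedPiece i n := fun i hi n hn =>
    GradedCech.cocycles_le_coboundaries_of_aInvariant_lt (hl i hi) hn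
  exact F.isAssociatedGraded.exists_isNumPoly F.gradedProj_mem
    (fun n a ha => F.gradedProj_self ha) (fun n x hx a => F.gradedProj_mul n hx a) hF hd hI
    hf.homogeneous hfM hcoh

/-- If the colengths of a family of ideals are given by a Hilbert sum, then they are given by the
Hilbert coefficients. -/
lemma isHilbertCoeffs_hilbertCoeff {R : Type*} [CommRing R] {J : ℤ → Ideal R} {d : ℕ}
    (hfin : ∀ n, Module.length R (R ⧸ J n) ≠ ⊤) {e : Fin (d + 1) → ℤ}
    (he : ∀ n : ℕ, colength (J (n + 1)) = hilbertSum d e n) :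
    IsHilbertCoeffs J d (hilbertCoeff J d) ∧
      ∀ n : ℕ, colength (J (n + 1)) = hilbertSum d (hilbertCoeff J d) n := by
  have hex : ∃ e, IsHilbertCoeffs J d e := ⟨e, Filter.Eventually.of_forall fun n => ⟨hfin _, he n⟩⟩
  have hspec : IsHilbertCoeffs J d (hilbertCoeff J d) := by
    rw [hilbertCoeff, dif_pos hex]
    exact hex.choose_spec
  refine ⟨hspec, fun n => ?_⟩
  obtain ⟨n₀, hn₀⟩ := Filter.eventually_atTop.mp hspec
  rw [he, hilbertSum_eq_of_eventually_eq fun n hn => (he n).symm.trans (hn₀ n hn).2]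

end

theorem proposition4p1 {R : Type*} [CommRing R] [IsLocalRing R]
    (hCM : IsCohenMacaulayLocalRing R) (hres : Infinite (IsLocalRing.ResidueField R))
    (d : ℕ) (hd : ringKrullDim R = d)
    (I : Ideal R) (hI : I.radical = IsLocalRing.maximalIdeal R)
    (F : MulFiltration R) (hF : F.IsAdmissible I)
    {r : ℕ} (f : Fin r → F.AssociatedGraded)
    (hf : IsHomogeneousSystem F.gradedPiece F.homogeneousMaximalIdeal f)
    (l : ℤ)
    (hl : ∀ i : ℕ, i ≤ d →
      GradedCech.aInvariant f F.gradedPiece F.gradedPiece i < ((l : WithTop ℤ) : WithBot (WithTop ℤ))) :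
    IsHilbertCoeffs (F.veronese l) d (hilbertCoeff (F.veronese l) d) ∧
    (∀ n : ℕ, Module.length R (R ⧸ F.ideal (l * (n + 1))) ≠ ⊤ ∧
      colength (F.ideal (l * (n + 1))) =
        ∑ i : Fin (d + 1), (-1) ^ (i : ℕ) * hilbertCoeff (F.veronese l) d i *
          ((n + d - i).choose (d - i) : ℤ)) ∧
    colength (F.ideal l) = ∑ i : Fin (d + 1), (-1) ^ (i : ℕ) * hilbertCoeff (F.veronese l) d i := by
  have := hCM.isNoetherianRing
  have hfin := hF.length_ne_top hd hI
  obtain ⟨Q, hQ, hval⟩ := hF.exists_isNumPoly_of_aInvariant_lt hres hd hI f hf hl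
  have hex : ∃ e : Fin (d + 1) → ℤ,
      ∀ n : ℕ, colength (F.veronese l (n + 1)) = hilbertSum d e n := by
    -- For `l ≤ 0` every `I_{l(n+1)}` is `R`, and zero coefficients serve. For `l > 0` the index
    -- `l(n+1)` stays in the range `≥ l` where `Q` is valid.
    rcases le_or_gt l 0 with h0 | h0
    · refine ⟨0, fun n => ?_⟩
      rw [MulFiltration.veronese, F.ideal_eq_top_of_nonpos
        (mul_nonpos_of_nonneg_of_nonpos (by positivity) h0), colength_top]
      simp [hilbertSum]
    · obtain ⟨e, he⟩ := (hQ.comp_affine l l).exists_eq_hilbertSum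
      refine ⟨e, fun n => ?_⟩
      rw [← he, MulFiltration.veronese, hval _ (by nlinarith)]
      congr 1
      ring
  obtain ⟨e, he⟩ := hex
  obtain ⟨h1, h2⟩ := isHilbertCoeffs_hilbertCoeff (J := F.veronese l)
    (fun n => hfin (n * l)) he
  have h3 : ∀ n : ℕ, colength (F.ideal (l * (n + 1))) =
      hilbertSum d (hilbertCoeff (F.veronese l) d) n := fun n => by
    rw [← h2 n, MulFiltration.veronese, mul_comm]
  refine ⟨h1, fun n => ⟨hfin _, h3 n⟩, ?_⟩
  have h4 := h3 0
  rw [Nat.cast_zero, zero_add, mul_one, hilbertSum] at h4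
  simpa only [zero_add, Nat.choose_self, Nat.cast_one, mul_one] using h4
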